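/- Let $\mu:\mathbb R\to(0,\infty)$ be a differentiable growth rate: $\mu$ is differentiable and strictly increasing, $\mu(0)=1$, $\mu(t)\to+\infty$ as $t\to+\infty$ and $\mu(t)\to0$ as $t\to-\infty$. Let $A:\mathbb R\to\mathbb R^{n\times n}$ be locally integrable, and let $\Psi(t,s)$ be the evolution operator of $x'=A(t)x$. Suppose this linear equation admits a nonuniform $\mu$-dichotomy: there are projections $\pi(t)$ with $\pi(t)\Psi(t,s)=\Psi(t,s)\pi(s)$ for all $t,s$, and constants $D\ge1$, $\lambda_s<0<\lambda_u$, $\nu,\omega\ge0$ with $\lambda_s+\nu<0$, $\lambda_u-\omega>0$, such that $$\|\Psi(t,s)\pi(s)\|\le D\Big(\frac{\mu(t)}{\mu(s)}\Big)^{\lambda_s}\mu(s)^{\operatorname{sign}(s)\nu}\ (t\ge s),\qquad \|\Psi(t,s)(\mathrm{id}-\pi(s))\|\le D\Big(\frac{\mu(t)}{\mu(s)}\Big)^{\lambda_u}\mu(s)^{\operatorname{sign}(s)\omega}\ (t\le s).$$ Put $X^s_t=\pi(t)\mathbb R^n$ and $X^u_t=(\mathrm{id}-\pi(t))\mathbb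 R^n$. Let $\theta\ge\max\{\nu,\omega\}$, $\lambda_s<\nu-\theta$ and $\lambda_u>\theta-\omega$. Let $f:\mathbb R\times\mathbb R^n\to\mathbb R^n$ be a Carathéodory function (measurable in $t$, continuous in $x$) with $f(t,0)=0$ and $$\|f(t,x)-f(t,\tilde x)\|\le \delta_f\,\mu(t)^{-1-\operatorname{sign}(t)\theta}\mu'(t)\,\|x-\tilde x\|\qquad\text{for all }t,x,\tilde x .$$ Solutions are understood in the Carathéodory sense on all of $\mathbb R$. For the equation $$x'=A(t)x+f(t,x)\tag{1}$$ let $x(\cdot,\tau,x)$ be the solution with value $x$ at time $\tau$. Let $W_s(\tau,x)$ (resp. $W_u(\tau,x)$), the leaf through $x$ of the stable (resp. unstable) foliation, be the set of all $y$ for which $x(t,\tau,x)-x(t,\tau,y)$ is bounded for $t\ge\tau$ (resp. $t\le\tau$). Then there is $\delta_0>0$, depending only on $D,\lambda_s,\lambda_u,\nu,\omega,\theta$, such that for $0<\delta_f<\delta_0$ the following holds. Consider the decoupled system $$x_s'=A(t)x_s+\pi(t)f(t,x_s),\quad x_s(t)\in X^s_t;\qquad x_u'=A(t)x_u+(\mathrm{id}-\pi(t))f(t,x_u),\quad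 x_u(t)\in X^u_t.\tag{2}$$ 1. The first equation of (2) is contractive: $\lambda_s+D\delta_f<0$, and any two of its solutions satisfy $\|x_s(t)-\tilde x_s(t)\|\le D(\mu(t)/\mu(\tau))^{\lambda_s+D\delta_f}\mu(\tau)^{\operatorname{sign}(\tau)\nu}\|x_s(\tau)-\tilde x_s(\tau)\|$ for $t\ge\tau$. The second is expansive: $\lambda_u-D\delta_f>0$, and any two of its solutions satisfy $\|x_u(t)-\tilde x_u(t)\|\le D(\mu(t)/\mu(\tau))^{\lambda_u-D\delta_f}\mu(\tau)^{\operatorname{sign}(\tau)\omega}\|x_u(\tau)-\tilde x_u(\tau)\|$ for $t\le\tau$. 2. There are homeomorphisms $\mathfrak S(t,\cdot):\mathbb R^n\to\mathbb R^n$, $t\in\mathbb R$, with $\mathfrak S(t,0)=0$, which conjugate (1) to (2): a curve $x:\mathbb R\to\mathbb R^n$ solves (1) if and only if $\pi(t)\mathfrak S(t,x(t))$ solves the first and $(\mathrm{id}-\pi(t))\mathfrak S(t,x(t))$ solves the second equation of (2). 3. $\mathfrak S(t,\cdot)$ straightens both foliations: $y\in W_s(t,x)$ if and only if $(\mathrm{id}-\pi(t))\mathfrak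 S(t,y)=(\mathrm{id}-\pi(t))\mathfrak S(t,x)$, and $y\in W_u(t,x)$ if and only if $\pi(t)\mathfrak S(t,y)=\pi(t)\mathfrak S(t,x)$. 4. If moreover $\pi(t)f(t,(\mathrm{id}-\pi(t))x)=0$ and $(\mathrm{id}-\pi(t))f(t,\pi(t)x)=0$ for all $t,x$ (so that the stable and unstable manifolds of $0$ are $X^s_t$ and $X^u_t$), then $W_s(t,x)\cap X^u_t=\{(\mathrm{id}-\pi(t))\mathfrak S(t,x)\}$ and $W_u(t,x)\cap X^s_t=\{\pi(t)\mathfrak S(t,x)\}$ for all $t,x$; that is, $\mathfrak S(t,x)$ is the sum of the points where the two leaves through $x$ meet $X^u_t$ and $X^s_t$. -/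

import Mathlib

open MeasureTheory Filter Topology

/-- The phase space `ℝⁿ` with its Euclidean norm. -/
abbrev Phase (n : ℕ) : Type := EuclideanSpace ℝ (Fin n)

/-- A (global) Carathéodory solution of `x' = F t x`, written in integrated form: `x` is continuous,
`r ↦ F r (x r)` is locally integrable, and `x t = x s + ∫ r in s..t, F r (x r)` for all `s`, `t`. -/
structure IsSolution {n : ℕ} (F : ℝ → Phase n → Phase n) (x : ℝ → Phase n) : Prop where
  continuous : Continuous x
  integrable : ∀ s t : ℝ, IntervalIntegrable (fun r => F r (x r)) volume s t
  eq_integral : ∀ s t : ℝ, x t = x s + ∫ r in s..t, F r (x r)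

/-- `Ψ t s` is the evolution operator of `x' = A t x`, i.e. `t ↦ Ψ t s` is the solution of the
matrix equation `X' = A t X`, `X s = id`, in integrated form. For locally integrable `A` there is
exactly one such `Ψ`. -/
structure IsEvolutionOperator {n : ℕ} (A : ℝ → Phase n →L[ℝ] Phase n)
    (Ψ : ℝ → ℝ → Phase n →L[ℝ] Phase n) : Prop where
  continuous : ∀ s : ℝ, Continuous (fun t => Ψ t s)
  eq_integral : ∀ s t : ℝ,
    Ψ t s = ContinuousLinearMap.id ℝ (Phase n) + ∫ r in s..t, (A r).comp (Ψ r s)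

/-- A differentiable growth rate. -/
structure IsDifferentiableGrowthRate (μ : ℝ → ℝ) : Prop where
  pos : ∀ t, 0 < μ t
  strictMono : StrictMono μ
  map_zero : μ 0 = 1
  tendsto_atTop : Tendsto μ atTop atTop
  tendsto_atBot : Tendsto μ atBot (𝓝 0)
  differentiable : Differentiable ℝ μ

/-- The linear equation with evolution operator `Ψ` admits a nonuniform `μ`-dichotomy with
projections `π t` and constants `D`, `lamS`, `lamU`, `ν`, `ω`. -/
structure HasNonuniformDichotomy {n : ℕ} (μ : ℝ → ℝ) (Ψ : ℝ → ℝ → Phase n →L[ℝ] Phase n)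
    (π : ℝ → Phase n →L[ℝ] Phase n) (D lamS lamU ν ω : ℝ) : Prop where
  one_le : 1 ≤ D
  lamS_neg : lamS < 0
  lamU_pos : 0 < lamU
  nu_nonneg : 0 ≤ ν
  omega_nonneg : 0 ≤ ω
  stable_gap : lamS + ν < 0
  unstable_gap : 0 < lamU - ω
  proj : ∀ t, (π t).comp (π t) = π t
  comm : ∀ t s, (π t).comp (Ψ t s) = (Ψ t s).comp (π s)
  stable_bound : ∀ t s, s ≤ t →
    ‖(Ψ t s).comp (π s)‖ ≤ D * (μ t / μ s) ^ lamS * μ s ^ (Real.sign s * ν)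
  unstable_bound : ∀ t s, t ≤ s →
    ‖(Ψ t s).comp (ContinuousLinearMap.id ℝ (Phase n) - π s)‖
      ≤ D * (μ t / μ s) ^ lamU * μ s ^ (Real.sign s * ω)

/-- The projection `id - π t` complementary to `π t`. -/
noncomputable def coProj {n : ℕ} (π : ℝ → Phase n →L[ℝ] Phase n) (t : ℝ) :
    Phase n →L[ℝ] Phase n :=
  ContinuousLinearMap.id ℝ (Phase n) - π t

/-- The stable subspace `π t (ℝⁿ)`, as a set. -/
def stableSubspace {n : ℕ} (π : ℝ → Phase n →L[ℝ] Phase n) (t : ℝ) : Set (Phase n) :=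
  Set.range (π t)

/-- The unstable subspace `(id - π t) (ℝⁿ)`, as a set. -/
def unstableSubspace {n : ℕ} (π : ℝ → Phase n →L[ℝ] Phase n) (t : ℝ) : Set (Phase n) :=
  Set.range (coProj π t)

/-- The Lipschitz weight `φ t = δ * μ(t) ^ (-1 - sign(t) θ) * μ'(t)`. -/
noncomputable def lipWeight (μ : ℝ → ℝ) (θ δ : ℝ) (t : ℝ) : ℝ :=
  δ * μ t ^ (-1 - Real.sign t * θ) * deriv μ t

/-- `f` is a Carathéodory function on `ℝ × ℝⁿ` with `f t 0 = 0` whose Lipschitz constant in `x` at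
time `t` is at most `φ t`. -/
structure IsAdmissiblePerturbation {n : ℕ} (φ : ℝ → ℝ) (f : ℝ → Phase n → Phase n) : Prop where
  continuous : ∀ᵐ t : ℝ, Continuous (f t)
  measurable : ∀ x, AEMeasurable (fun t => f t x) (volume : Measure ℝ)
  map_zero : ∀ t, f t 0 = 0
  lipschitz : ∀ t x y, ‖f t x - f t y‖ ≤ φ t * ‖x - y‖

/-- Right-hand side of the nonlinear equation `x' = A t x + f t x`. -/
def fullField {n : ℕ} (A : ℝ → Phase n →L[ℝ] Phase n) (f : ℝ → Phase n → Phase n)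
    (t : ℝ) (x : Phase n) : Phase n :=
  A t x + f t x

/-- Right-hand side of the first decoupled equation `y' = A t y + π t (f t y)`; it is considered on
the stable subspaces. -/
def stableField {n : ℕ} (A π : ℝ → Phase n →L[ℝ] Phase n) (f : ℝ → Phase n → Phase n)
    (t : ℝ) (y : Phase n) : Phase n :=
  A t y + π t (f t y)

/-- Right-hand side of the second decoupled equation `z' = A t z + (id - π t) (f t z)`; it is
considered on the unstable subspaces. -/
noncomputable def unstableField {n : ℕ} (A π : ℝ → Phase n →L[ℝ] Phase n)
    (f : ℝ → Phase n → Phase n) (t : ℝ) (z : Phase n) : Phase n :=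
  A t z + coProj π t (f t z)

/-- The leaf through `x` at time `τ` of the stable foliation of `x' = F t x`: all `y` such that the
solutions through `(τ, x)` and `(τ, y)` stay at bounded distance on `[τ, ∞)`. -/
def stableLeaf {n : ℕ} (F : ℝ → Phase n → Phase n) (τ : ℝ) (x : Phase n) : Set (Phase n) :=
  {y | ∃ u v : ℝ → Phase n, IsSolution F u ∧ IsSolution F v ∧ u τ = x ∧ v τ = y ∧
    ∃ M : ℝ, ∀ t, τ ≤ t → ‖u t - v t‖ ≤ M}

/-- The leaf through `x` at time `τ` of the unstable foliation of `x' = F t x`: all `y` such that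
the solutions through `(τ, x)` and `(τ, y)` stay at bounded distance on `(-∞, τ]`. -/
def unstableLeaf {n : ℕ} (F : ℝ → Phase n → Phase n) (τ : ℝ) (x : Phase n) : Set (Phase n) :=
  {y | ∃ u v : ℝ → Phase n, IsSolution F u ∧ IsSolution F v ∧ u τ = x ∧ v τ = y ∧
    ∃ M : ℝ, ∀ t, t ≤ τ → ‖u t - v t‖ ≤ M}

/-- Solutions of `y' = F t y` lying in the subspaces `X t` contract forward in time at the
`μ`-rate `ρ`. -/
def ContractsAtRate {n : ℕ} (μ : ℝ → ℝ) (F : ℝ → Phase n → Phase n) (X : ℝ → Set (Phase n))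
    (D ρ ν : ℝ) : Prop :=
  ∀ u v : ℝ → Phase n, IsSolution F u → IsSolution F v → (∀ t, u t ∈ X t) → (∀ t, v t ∈ X t) →
    ∀ t τ, τ ≤ t →
      ‖u t - v t‖ ≤ D * (μ t / μ τ) ^ ρ * μ τ ^ (Real.sign τ * ν) * ‖u τ - v τ‖

/-- Solutions of `z' = F t z` lying in the subspaces `X t` expand at the `μ`-rate `ρ`, i.e. they
contract backward in time. -/
def ExpandsAtRate {n : ℕ} (μ : ℝ → ℝ) (F : ℝ → Phase n → Phase n) (X : ℝ → Set (Phase n))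
    (D ρ ω : ℝ) : Prop :=
  ∀ u v : ℝ → Phase n, IsSolution F u → IsSolution F v → (∀ t, u t ∈ X t) → (∀ t, v t ∈ X t) →
    ∀ t τ, t ≤ τ →
      ‖u t - v t‖ ≤ D * (μ t / μ τ) ^ ρ * μ τ ^ (Real.sign τ * ω) * ‖u τ - v τ‖

/-! The conjugacy is built at time `0` and then carried to every other time by flows. At time `0`
the dichotomy bounds have no nonuniform factor, because `μ 0 = 1`; at later times of integration
that factor is absorbed by the Lipschitz weight of `f`, since `θ` dominates both `ν` and `ω`.

Two solutions that stay at bounded distance on `[0, ∞)` satisfy the Lyapunov–Perron identities: the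
unstable part of their difference is a convergent tail integral of the nonlinearity, the stable part
is its initial value plus an integral over the past. For small `δ` this turns any finite bound into
an explicit one (`norm_sub_le_of_bounded`), so lying on the same stable leaf is a closed relation,
and leaves are graphs over the range of `π 0` with slope at most `1 / (4 * D)`
(`norm_coProj_zero_sub_le`). A fixed point of the Lyapunov–Perron operator shows that these graphs
are defined on the whole range (`exists_mem_stableLeaf`). Reversing time, with growth rate `1 / μ
(-t)`, exchanges the stable and unstable sides (`PerturbedDichotomy.reverse`), so only one of them
is ever estimated.

Two such foliations with small slopes are straightened together
(`IsLipschitzFoliation.exists_homeomorph`): slide `x` along its stable leaf to `ker (π 0)` and along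
its unstable leaf to the range of `π 0`, and add the two points. The resulting map `S₀` is bijective
because a leaf of one foliation meets a leaf of the other exactly once, by a contraction argument,
and a linear growth estimate makes the inverse continuous.

With `Φ` the flow of the full equation and `Θ` that of the decoupled one, both from time `0`, the
conjugacy is `Θ t ∘ S₀ ∘ (Φ t)⁻¹` (`exists_conjugacy`). It straightens the leaves at every time
because `Φ` maps leaves to leaves and `Θ` respects the splitting. The contraction and expansion
rates are a separate matter, settled by Gronwall's inequality (`contractsAtRate`). -/

/-! ### Indefinite integrals of locally integrable functions, and Gronwall's inequality -/

section Primitives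

theorem locallyIntegrable_of_intervalIntegrable {E : Type*} [NormedAddCommGroup E]
    {h : ℝ → E}
    (hh : ∀ a b, IntervalIntegrable h volume a b) : LocallyIntegrable h volume := by
  rw [locallyIntegrable_iff]
  intro K hK
  obtain ⟨a, ha⟩ := hK.bddBelow
  obtain ⟨b, hb⟩ := hK.bddAbove
  have h1 := (hh a (max a b)).def'
  rw [Set.uIoc_of_le (le_max_left _ _), ← integrableOn_Icc_iff_integrableOn_Ioc] at h1
  exact h1.mono_set fun x hx => ⟨ha hx, (hb hx).trans (le_max_right _ _)⟩

theorem intervalIntegrable_of_locallyIntegrable {E : Type*} [NormedAddCommGroup E]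
    {h : ℝ → E} (hh : LocallyIntegrable h volume)
    (a b : ℝ) : IntervalIntegrable h volume a b :=
  intervalIntegrable_iff.mpr
    ((hh.integrableOn_isCompact isCompact_uIcc).mono_set Set.uIoc_subset_uIcc)

variable {E F : Type*} [NormedAddCommGroup E] [NormedSpace ℝ E] [NormedAddCommGroup F]
  [NormedSpace ℝ F]

theorem AbsolutelyContinuousOnInterval.of_dist_le {X Y : Type*} [PseudoMetricSpace X]
    [PseudoMetricSpace Y] {f : ℝ → X} {g : ℝ → Y} {a b C : ℝ}
    (hg : AbsolutelyContinuousOnInterval g a b)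
    (h : ∀ s ∈ Set.uIcc a b, ∀ t ∈ Set.uIcc a b, dist (f s) (f t) ≤ C * dist (g s) (g t)) :
    AbsolutelyContinuousOnInterval f a b := by
  have hlim := Tendsto.const_mul C hg
  rw [mul_zero] at hlim
  refine squeeze_zero' (Eventually.of_forall fun I => Finset.sum_nonneg fun _ _ => dist_nonneg)
    ?_ hlim
  filter_upwards [mem_inf_of_right (mem_principal_self _)] with I hI
  rw [Finset.mul_sum]
  exact Finset.sum_le_sum fun i hi => h _ (hI.1 i hi).1 _ (hI.1 i hi).2

/-- `H` is an indefinite integral of the locally integrable function `h`. -/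
structure IsPrimitive (h H : ℝ → E) : Prop where
  integrable : ∀ a b, IntervalIntegrable h volume a b
  eq_integral : ∀ a b, H b = H a + ∫ r in a..b, h r

theorem IsPrimitive.of_base {h H : ℝ → E} (hh : ∀ a b, IntervalIntegrable h volume a b) (a : ℝ)
    (hH : ∀ t, H t = H a + ∫ r in a..t, h r) : IsPrimitive h H := by
  refine ⟨hh, fun s t => ?_⟩
  rw [hH t, hH s, add_assoc, intervalIntegral.integral_add_adjacent_intervals (hh _ _) (hh _ _)]

theorem isPrimitive_integral {h : ℝ → E} (hh : ∀ a b, IntervalIntegrable h volume a b) (a : ℝ)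
    (c : E) : IsPrimitive h (fun t => c + ∫ r in a..t, h r) :=
  .of_base hh a fun t => by simp

theorem IsPrimitive.integral_eq_sub {h H : ℝ → E} (hH : IsPrimitive h H) (a b : ℝ) :
    ∫ r in a..b, h r = H b - H a := by
  rw [hH.eq_integral a b]; abel

theorem IsPrimitive.continuous {h H : ℝ → E} (hH : IsPrimitive h H) : Continuous H := by
  have : H = fun t => H 0 + ∫ r in (0 : ℝ)..t, h r := funext fun t => hH.eq_integral 0 t
  rw [this]
  exact continuous_const.add (intervalIntegral.continuous_primitive hH.integrable 0)

theorem IsPrimitive.norm {h H : ℝ → E} (hH : IsPrimitive h H) :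
    IsPrimitive (fun r => ‖h r‖) (fun t => ∫ r in (0 : ℝ)..t, ‖h r‖) :=
  .of_base (fun a b => (hH.integrable a b).norm) 0 fun t => by simp

/-- Transfers absolute continuity from a scalar primitive to every vector-valued primitive whose
density it dominates. -/
theorem IsPrimitive.dist_le {h H : ℝ → E} (hH : IsPrimitive h H) {k K : ℝ → ℝ}
    (hK : IsPrimitive k K) (hle : ∀ r, ‖h r‖ ≤ k r) (s t : ℝ) :
    dist (H s) (H t) ≤ dist (K s) (K t) := by
  rw [dist_comm, dist_comm (K s), dist_eq_norm, dist_eq_norm, ← hH.integral_eq_sub,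
    ← hK.integral_eq_sub]
  refine (intervalIntegral.norm_integral_le_abs_of_norm_le
    (Eventually.of_forall fun r => hle r) (hK.integrable s t)).trans ?_
  exact le_of_eq (Real.norm_eq_abs _).symm

theorem IsPrimitive.absolutelyContinuous_real {k K : ℝ → ℝ} (hK : IsPrimitive k K) (a b : ℝ) :
    AbsolutelyContinuousOnInterval K a b := by
  refine ((hK.integrable a b).absolutelyContinuousOnInterval_intervalIntegral
    (c := a) (by simp)).of_dist_le (C := 1) fun s _ t _ => ?_
  rw [hK.eq_integral a s, hK.eq_integral a t, dist_add_left, one_mul]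

theorem IsPrimitive.absolutelyContinuous {h H : ℝ → E} (hH : IsPrimitive h H) (a b : ℝ) :
    AbsolutelyContinuousOnInterval H a b :=
  (hH.norm.absolutelyContinuous_real a b).of_dist_le (C := 1) fun s _ t _ => by
    rw [one_mul]; exact hH.dist_le hH.norm (fun _ => le_rfl) s t

theorem IsPrimitive.ae_hasDerivAt [CompleteSpace E] {h H : ℝ → E} (hH : IsPrimitive h H) :
    ∀ᵐ t, HasDerivAt H (h t) t := by
  filter_upwards [LocallyIntegrable.ae_hasDerivAt_integral
    (locallyIntegrable_of_intervalIntegrable hH.integrable)]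
    with t ht
  have : H = fun t => H 0 + ∫ r in (0 : ℝ)..t, h r := funext fun t => hH.eq_integral 0 t
  rw [this]
  exact (ht 0).const_add _

/-- The fundamental theorem of calculus for absolutely continuous functions. -/
theorem IsPrimitive.of_absolutelyContinuous [CompleteSpace E] {h H : ℝ → E}
    (hh : ∀ a b, IntervalIntegrable h volume a b)
    (hac : ∀ a b, AbsolutelyContinuousOnInterval H a b) (hd : ∀ᵐ t, HasDerivAt H (h t) t) :
    IsPrimitive h H := by
  refine ⟨hh, fun a b => ?_⟩
  have hG := isPrimitive_integral hh a (0 : E)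
  have hGd := hG.ae_hasDerivAt
  obtain ⟨C, hC⟩ := ((hac a b).sub (hG.absolutelyContinuous a b)).const_of_ae_hasDerivAt_zero (by
    filter_upwards [hd, hGd] with t h1 h2 _
    simpa using h1.sub h2)
  have ha := hC a (by simp)
  have hb := hC b (by simp)
  simp only [Pi.sub_apply, intervalIntegral.integral_same, zero_add, sub_zero] at ha hb
  rw [ha, ← hb]; abel

theorem IsPrimitive.add {h h' H H' : ℝ → E} (hH : IsPrimitive h H) (hH' : IsPrimitive h' H') :
    IsPrimitive (fun t => h t + h' t) (fun t => H t + H' t) := by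
  refine ⟨fun a b => (hH.integrable a b).add (hH'.integrable a b), fun a b => ?_⟩
  rw [intervalIntegral.integral_add (hH.integrable a b) (hH'.integrable a b), hH.eq_integral a b,
    hH'.eq_integral a b]
  abel

theorem IsPrimitive.sub {h h' H H' : ℝ → E} (hH : IsPrimitive h H) (hH' : IsPrimitive h' H') :
    IsPrimitive (fun t => h t - h' t) (fun t => H t - H' t) := by
  refine ⟨fun a b => (hH.integrable a b).sub (hH'.integrable a b), fun a b => ?_⟩
  rw [intervalIntegral.integral_sub (hH.integrable a b) (hH'.integrable a b), hH.eq_integral a b,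
    hH'.eq_integral a b]
  abel

theorem IsPrimitive.clm [CompleteSpace E] [CompleteSpace F] {h H : ℝ → E} (hH : IsPrimitive h H)
    (T : E →L[ℝ] F) : IsPrimitive (fun t => T (h t)) (fun t => T (H t)) := by
  have hi : ∀ a b, IntervalIntegrable (fun t => T (h t)) volume a b := fun a b =>
    ⟨T.integrable_comp (hH.integrable a b).1, T.integrable_comp (hH.integrable a b).2⟩
  refine ⟨hi, fun a b => ?_⟩
  rw [T.intervalIntegral_comp_comm (hH.integrable a b), ← map_add, ← hH.eq_integral a b]

theorem IsPrimitive.comp_neg {h H : ℝ → E} (hH : IsPrimitive h H) :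
    IsPrimitive (fun t => -h (-t)) (fun t => H (-t)) := by
  refine ⟨fun a b => ?_, fun a b => ?_⟩
  · have := (IntervalIntegrable.iff_comp_neg (f := h) (a := -a) (b := -b)).mp (hH.integrable (-a) (-b))
    rw [neg_neg, neg_neg] at this
    exact this.neg
  · rw [intervalIntegral.integral_neg, intervalIntegral.integral_comp_neg (fun t => h t),
      hH.integral_eq_sub]
    abel

theorem IsPrimitive.intervalIntegrable_apply [CompleteSpace F] {h H : ℝ → E}
    (hH : IsPrimitive h H) {U : ℝ → E →L[ℝ] F} (hU : Continuous U) (a b : ℝ) :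
    IntervalIntegrable (fun t => U t (h t)) volume a b := by
  obtain ⟨C, hC⟩ := (isCompact_uIcc (a := a) (b := b)).exists_bound_of_continuousOn
    hU.continuousOn
  have hint := (hH.integrable a b).def'
  refine intervalIntegrable_iff.mpr ((hint.norm.const_mul C).mono' ?_ ?_)
  · exact (ContinuousLinearMap.aestronglyMeasurable_comp₂
      (ContinuousLinearMap.id ℝ (E →L[ℝ] F)) hU.aestronglyMeasurable hint.aestronglyMeasurable)
  · filter_upwards [ae_restrict_mem measurableSet_uIoc] with t ht
    exact (U t).le_of_opNorm_le (hC t (Set.uIoc_subset_uIcc ht)) _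

theorem intervalIntegrable_clm_apply {V : ℝ → E →L[ℝ] F} {z : ℝ → E}
    (hV : ∀ a b, IntervalIntegrable V volume a b) (hz : Continuous z) (a b : ℝ) :
    IntervalIntegrable (fun t => V t (z t)) volume a b := by
  obtain ⟨C, hC⟩ := (isCompact_uIcc (a := a) (b := b)).exists_bound_of_continuousOn
    hz.continuousOn
  have hint := (hV a b).def'
  refine intervalIntegrable_iff.mpr ((hint.norm.mul_const C).mono' ?_ ?_)
  · exact (ContinuousLinearMap.aestronglyMeasurable_comp₂
      (ContinuousLinearMap.id ℝ (E →L[ℝ] F)) hint.aestronglyMeasurable hz.aestronglyMeasurable)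
  · filter_upwards [ae_restrict_mem measurableSet_uIoc] with t ht
    exact (V t).le_opNorm_of_le (hC t (Set.uIoc_subset_uIcc ht))

/-- The product rule for indefinite integrals. -/
theorem IsPrimitive.clm_apply [CompleteSpace E] [CompleteSpace F] {u U : ℝ → E →L[ℝ] F}
    {z Z : ℝ → E} (hU : IsPrimitive u U) (hZ : IsPrimitive z Z) :
    IsPrimitive (fun t => u t (Z t) + U t (z t)) (fun t => U t (Z t)) := by
  refine .of_absolutelyContinuous (fun a b => (intervalIntegrable_clm_apply 
    hU.integrable hZ.continuous a b).add (hZ.intervalIntegrable_apply hU.continuous a b))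
    (fun a b => ?_) ?_
  · obtain ⟨C, hC⟩ := (isCompact_uIcc (a := a) (b := b)).exists_bound_of_continuousOn
      hU.continuous.continuousOn
    obtain ⟨C', hC'⟩ := (isCompact_uIcc (a := a) (b := b)).exists_bound_of_continuousOn
      hZ.continuous.continuousOn
    -- One scalar primitive dominates the increments of both factors, so the product inherits its
    -- absolute continuity.
    have hK := hU.norm.add hZ.norm
    refine (hK.absolutelyContinuous_real a b).of_dist_le (C := C + C') fun s hs t ht => ?_
    have h1 := hU.dist_le hK (fun r => le_add_of_nonneg_right (norm_nonneg _)) s t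
    have h2 := hZ.dist_le hK (fun r => le_add_of_nonneg_left (norm_nonneg _)) s t
    rw [dist_eq_norm] at h1 h2
    have h3 : U s (Z s) - U t (Z t) = (U s - U t) (Z s) + U t (Z s - Z t) := by simp
    rw [dist_eq_norm, h3]
    have hC0 := (norm_nonneg _).trans (hC t ht)
    have hC0' := (norm_nonneg _).trans (hC' s hs)
    calc _ ≤ ‖U s - U t‖ * C' + C * ‖Z s - Z t‖ :=
          norm_add_le_of_le ((U s - U t).le_opNorm_of_le (hC' s hs))
            ((U t).le_of_opNorm_le (hC t ht) _)
      _ ≤ _ := by nlinarith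
  · filter_upwards [hU.ae_hasDerivAt, hZ.ae_hasDerivAt] with t h1 h2
    exact h1.clm_apply h2

theorem IsPrimitive.exp {k K : ℝ → ℝ} (hK : IsPrimitive k K) :
    IsPrimitive (fun t => Real.exp (K t) * k t) (fun t => Real.exp (K t)) := by
  have hexp : Continuous fun t => Real.exp (K t) := Real.continuous_exp.comp hK.continuous
  refine .of_absolutelyContinuous
    (fun a b => (hK.integrable a b).continuousOn_mul hexp.continuousOn) (fun a b => ?_) ?_
  · obtain ⟨C, hC⟩ := (isCompact_uIcc (a := a) (b := b)).exists_bound_of_continuousOn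
      hK.continuous.continuousOn
    refine (hK.absolutelyContinuous_real a b).of_dist_le (C := Real.exp C) fun s hs t ht => ?_
    have := (convex_Iic C).norm_image_sub_le_of_norm_deriv_le (f := Real.exp) (C := Real.exp C)
      (x := K t) (y := K s) (fun x _ => Real.differentiableAt_exp)
      (fun x hx => by simpa using hx) ((le_abs_self _).trans (hC t ht))
      ((le_abs_self _).trans (hC s hs))
    simpa [dist_eq_norm] using this
  · filter_upwards [hK.ae_hasDerivAt] with t ht
    exact ht.exp

/-- Integral form of Gronwall's inequality with a locally integrable kernel. -/
theorem gronwall_of_le_integral {k K g : ℝ → ℝ} {C s : ℝ} (hK : IsPrimitive k K)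
    (hk : ∀ r, 0 ≤ k r) (hg : Continuous g)
    (h : ∀ t, s ≤ t → g t ≤ C + ∫ r in s..t, k r * g r) (t : ℝ) (hst : s ≤ t) :
    g t ≤ C * Real.exp (K t - K s) := by
  have hL : IsPrimitive k (fun t => K t - K s) :=
    ⟨hK.integrable, fun a b => by rw [hK.eq_integral a b]; ring⟩
  -- It suffices to prove the bound with every `C' > C`. The strict margin gives a contradiction at
  -- the first time `m` where `g` reaches `C' * exp`: up to `m` the integral is at most `C' * (exp -
  -- 1)`, hence `g m ≤ C + C' * (exp - 1) < C' * exp`.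
  refine le_of_forall_gt_imp_ge_of_dense fun B hB => ?_
  have hE : 0 < Real.exp (K t - K s) := Real.exp_pos _
  obtain ⟨C', hC', rfl⟩ : ∃ C', C < C' ∧ C' * Real.exp (K t - K s) = B :=
    ⟨B / Real.exp (K t - K s), by rwa [lt_div_iff₀ hE], by field_simp⟩
  by_contra! hcon
  have hcont : Continuous fun r => C' * Real.exp (K r - K s) :=
    continuous_const.mul (Real.continuous_exp.comp hL.continuous)
  set Z : Set ℝ := {r | s ≤ r ∧ C' * Real.exp (K r - K s) ≤ g r} with hZ
  have hZc : IsClosed Z := isClosed_Ici.inter (isClosed_le hcont hg)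
  have hZb : BddBelow Z := ⟨s, fun r hr => hr.1⟩
  have hm : sInf Z ∈ Z := hZc.csInf_mem ⟨t, hst, hcon.le⟩ hZb
  set m := sInf Z
  have hlt : ∀ r, s ≤ r → r < m → g r ≤ C' * Real.exp (K r - K s) := fun r hr hrm => by
    by_contra! hc
    exact (not_lt.mpr (csInf_le hZb ⟨hr, hc.le⟩)) hrm
  have hint : ∫ r in s..m, k r * g r ≤ ∫ r in s..m, C' * (Real.exp (K r - K s) * k r) := by
    refine intervalIntegral.integral_mono_on_of_le_Ioo hm.1
      ((hK.integrable s m).mul_continuousOn hg.continuousOn)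
      ((hL.exp.integrable s m).const_mul C') fun r hr => ?_
    have := mul_le_mul_of_nonneg_left (hlt r hr.1.le hr.2) (hk r)
    linarith
  rw [intervalIntegral.integral_const_mul, hL.exp.integral_eq_sub, sub_self, Real.exp_zero] at hint
  have h1 := h m hm.1
  have h2 := hm.2
  linarith

end Primitives

theorem exists_fixedPoint_of_norm_sub_le {X : Type*} [NormedAddCommGroup X] [CompleteSpace X]
    {T : X → X} {q : ℝ} (hq : q < 1) (hT : ∀ v w, ‖T v - T w‖ ≤ q * ‖v - w‖) : ∃ v, T v = v := by
  have hc : ContractingWith (Real.toNNReal q) T := by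
    refine ⟨by simpa using hq, LipschitzWith.of_dist_le_mul fun v w => ?_⟩
    rw [dist_eq_norm, dist_eq_norm]
    exact (hT v w).trans (mul_le_mul_of_nonneg_right (Real.le_coe_toNNReal q) (norm_nonneg _))
  exact ⟨_, hc.fixedPoint_isFixedPt⟩

theorem continuous_of_norm_sub_le {X Y : Type*} [SeminormedAddCommGroup X]
    [SeminormedAddCommGroup Y] {g : X → Y} {C : ℝ} (h : ∀ x y, ‖g x - g y‖ ≤ C * ‖x - y‖) :
    Continuous g :=
  (LipschitzWith.of_dist_le_mul (K := Real.toNNReal C) fun x y => by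
    rw [dist_eq_norm, dist_eq_norm]
    exact (h x y).trans
      (mul_le_mul_of_nonneg_right (Real.le_coe_toNNReal C) (norm_nonneg _))).continuous

/-! ### Global existence, uniqueness and flows for Carathéodory–Lipschitz fields -/

section Caratheodory

variable {n : ℕ}

/-- A Carathéodory vector field vanishing at the origin with a locally integrable Lipschitz
constant `k`. -/
structure IsCaratheodoryLipschitz (F : ℝ → Phase n → Phase n) (k : ℝ → ℝ) : Prop where
  integrable : ∀ a b, IntervalIntegrable k volume a b
  nonneg : ∀ t, 0 ≤ k t
  measurable : ∀ x, AEStronglyMeasurable (fun t => F t x) volume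
  map_zero : ∀ t, F t 0 = 0
  lipschitz : ∀ t x y, ‖F t x - F t y‖ ≤ k t * ‖x - y‖

/-- For a simple function in place of `u` the composition is a finite sum of measurable pieces;
continuity in the space variable passes to the limit along simple approximations of `u`. -/
theorem aestronglyMeasurable_superposition {F : ℝ → Phase n → Phase n}
    (hm : ∀ x, AEStronglyMeasurable (fun t => F t x) volume) (hc : ∀ t, Continuous (F t))
    {u : ℝ → Phase n} (hu : Continuous u) : AEStronglyMeasurable (fun t => F t (u t)) volume := by
  have hs : ∀ s : SimpleFunc ℝ (Phase n), AEStronglyMeasurable (fun t => F t (s t)) volume := by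
    intro s
    have : (fun t => F t (s t)) =
        fun t => ∑ c ∈ s.range, (s ⁻¹' {c}).indicator (fun t => F t c) t := by
      funext t
      rw [Finset.sum_eq_single (s t)]
      · simp
      · intro c _ hc
        simp [hc.symm]
      · intro h
        exact absurd (s.mem_range_self t) h
    rw [this]
    exact Finset.aestronglyMeasurable_fun_sum _ fun c _ =>
      (hm c).indicator (s.measurableSet_fiber c)
  have hus := hu.stronglyMeasurable
  exact aestronglyMeasurable_of_tendsto_ae atTop (fun k => hs (hus.approx k))
    (Eventually.of_forall fun t => ((hc t).tendsto (u t)).comp (hus.tendsto_approx t))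

namespace IsCaratheodoryLipschitz

variable {F : ℝ → Phase n → Phase n} {k : ℝ → ℝ}

theorem continuous (hF : IsCaratheodoryLipschitz F k) (t : ℝ) : Continuous (F t) :=
  continuous_of_norm_sub_le (hF.lipschitz t)

theorem norm_le (hF : IsCaratheodoryLipschitz F k) (t : ℝ) (x : Phase n) :
    ‖F t x‖ ≤ k t * ‖x‖ := by
  simpa [hF.map_zero] using hF.lipschitz t x 0

theorem intervalIntegrable (hF : IsCaratheodoryLipschitz F k) {u : ℝ → Phase n}
    (hu : Continuous u) (a b : ℝ) : IntervalIntegrable (fun t => F t (u t)) volume a b := by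
  have hb := ((hF.integrable a b).mul_continuousOn hu.norm.continuousOn).def'
  exact intervalIntegrable_iff.mpr (hb.mono'
    (aestronglyMeasurable_superposition hF.measurable hF.continuous hu).restrict
    (Eventually.of_forall fun t => hF.norm_le t _))

end IsCaratheodoryLipschitz

theorem IsSolution.isPrimitive {F : ℝ → Phase n → Phase n} {u : ℝ → Phase n}
    (hu : IsSolution F u) : IsPrimitive (fun t => F t (u t)) u :=
  ⟨hu.integrable, hu.eq_integral⟩

theorem IsPrimitive.isSolution {F : ℝ → Phase n → Phase n} {u : ℝ → Phase n}
    (hu : IsPrimitive (fun t => F t (u t)) u) : IsSolution F u :=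
  ⟨hu.continuous, hu.integrable, fun s t => hu.eq_integral s t⟩

/-- The vector field obtained by reversing time. -/
def reverseField (F : ℝ → Phase n → Phase n) (t : ℝ) (x : Phase n) : Phase n := -F (-t) x

theorem IsSolution.reverse {F : ℝ → Phase n → Phase n} {u : ℝ → Phase n} (hu : IsSolution F u) :
    IsSolution (reverseField F) (fun t => u (-t)) :=
  IsPrimitive.isSolution hu.isPrimitive.comp_neg

theorem reverseField_reverseField (F : ℝ → Phase n → Phase n) :
    reverseField (reverseField F) = F := by
  funext t x; simp [reverseField]

theorem IsCaratheodoryLipschitz.reverse {F : ℝ → Phase n → Phase n} {k : ℝ → ℝ}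
    (hF : IsCaratheodoryLipschitz F k) :
    IsCaratheodoryLipschitz (reverseField F) (fun t => k (-t)) where
  integrable a b := by
    have := (IntervalIntegrable.iff_comp_neg (f := k) (a := -a) (b := -b)).mp
      (hF.integrable (-a) (-b))
    rwa [neg_neg, neg_neg] at this
  nonneg t := hF.nonneg _
  measurable x := ((hF.measurable x).comp_quasiMeasurePreserving
    (Measure.measurePreserving_neg volume).quasiMeasurePreserving).neg
  map_zero t := by simp [reverseField, hF.map_zero]
  lipschitz t x y := by
    rw [reverseField, reverseField, ← norm_neg]
    simpa [neg_add_eq_sub] using hF.lipschitz (-t) x y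

namespace IsCaratheodoryLipschitz

variable {F : ℝ → Phase n → Phase n} {k : ℝ → ℝ}

theorem norm_sub_le_exp_of_le (hF : IsCaratheodoryLipschitz F k) {u v : ℝ → Phase n}
    (hu : IsSolution F u) (hv : IsSolution F v) {s t : ℝ} (hst : s ≤ t) :
    ‖u t - v t‖ ≤ ‖u s - v s‖ * Real.exp (∫ r in s..t, k r) := by
  have hK := isPrimitive_integral hF.integrable s 0
  have := gronwall_of_le_integral (g := fun t => ‖u t - v t‖) (C := ‖u s - v s‖) hK hF.nonneg
    (hu.continuous.sub hv.continuous).norm (fun t hst => ?_) t hst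
  · simpa using this
  · have hd := hu.isPrimitive.sub hv.isPrimitive
    rw [hd.eq_integral s t]
    refine (norm_add_le _ _).trans (add_le_add_right ?_ _)
    exact intervalIntegral.norm_integral_le_of_norm_le hst
      (Eventually.of_forall fun r _ => hF.lipschitz r _ _)
      ((hF.integrable s t).mul_continuousOn
        (hu.continuous.sub hv.continuous).norm.continuousOn)

theorem exists_norm_sub_le (hF : IsCaratheodoryLipschitz F k) (s t : ℝ) :
    ∃ C : ℝ, ∀ u v : ℝ → Phase n, IsSolution F u → IsSolution F v →
      ‖u t - v t‖ ≤ C * ‖u s - v s‖ := by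
  rcases le_total s t with h | h
  · refine ⟨Real.exp (∫ r in s..t, k r), fun u v hu hv => ?_⟩
    rw [mul_comm]
    exact hF.norm_sub_le_exp_of_le hu hv h
  · refine ⟨Real.exp (∫ r in -s..-t, k (-r)), fun u v hu hv => ?_⟩
    rw [mul_comm]
    simpa only [neg_neg] using hF.reverse.norm_sub_le_exp_of_le hu.reverse hv.reverse (neg_le_neg h)

theorem eq_of_eq (hF : IsCaratheodoryLipschitz F k) {u v : ℝ → Phase n} (hu : IsSolution F u)
    (hv : IsSolution F v) {s : ℝ} (hs : u s = v s) (t : ℝ) : u t = v t := by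
  obtain ⟨C, hC⟩ := hF.exists_norm_sub_le s t
  have := hC u v hu hv
  rw [hs, sub_self, norm_zero, mul_zero] at this
  exact sub_eq_zero.mp (norm_le_zero_iff.mp this)

/-- With `K = |∫ k|`, the integrand is half the derivative of `exp (2 K)` up to sign, on either side
of `s`. The factor `2` in the exponent becomes the contraction constant `1 / 2` of the Picard
operator. -/
theorem abs_integral_mul_exp_le {k : ℝ → ℝ} (hki : ∀ a b, IntervalIntegrable k volume a b)
    (hk : ∀ r, 0 ≤ k r) (s t : ℝ) :
    |∫ r in s..t, k r * Real.exp (2 * |∫ q in s..r, k q|)|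
      ≤ Real.exp (2 * |∫ q in s..t, k q|) / 2 := by
  have key : ∀ c : ℝ, IsPrimitive (fun r => Real.exp (c * ∫ q in s..r, k q) * (c * k r))
      (fun r => Real.exp (c * ∫ q in s..r, k q)) := fun c => by
    refine IsPrimitive.exp ?_
    have h := isPrimitive_integral hki s 0
    refine .of_base (fun a b => (hki a b).const_mul c) s fun t => ?_
    simp [intervalIntegral.integral_const_mul]
  rcases le_total s t with h | h
  · have h1 : ∫ r in s..t, k r * Real.exp (2 * |∫ q in s..r, k q|)
        = ∫ r in s..t, (1 / 2) * (Real.exp (2 * ∫ q in s..r, k q) * (2 * k r)) := by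
      refine intervalIntegral.integral_congr fun r hr => ?_
      rw [Set.uIcc_of_le h] at hr
      rw [abs_of_nonneg (intervalIntegral.integral_nonneg hr.1 fun q _ => hk q)]
      ring
    rw [h1, intervalIntegral.integral_const_mul, (key 2).integral_eq_sub,
      abs_of_nonneg (intervalIntegral.integral_nonneg h fun q _ => hk q),
      intervalIntegral.integral_same, mul_zero, Real.exp_zero, abs_of_nonneg]
    · linarith
    · have := Real.one_le_exp (x := 2 * ∫ q in s..t, k q)
        (mul_nonneg two_pos.le (intervalIntegral.integral_nonneg h fun q _ => hk q))
      linarith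
  · have hneg : ∀ r, r ≤ s → |∫ q in s..r, k q| = -∫ q in s..r, k q := fun r hr => by
      rw [intervalIntegral.integral_symm, abs_neg, neg_neg,
        abs_of_nonneg (intervalIntegral.integral_nonneg hr fun q _ => hk q)]
    have h1 : ∫ r in s..t, k r * Real.exp (2 * |∫ q in s..r, k q|)
        = ∫ r in s..t, (-1 / 2) * (Real.exp (-2 * ∫ q in s..r, k q) * (-2 * k r)) := by
      refine intervalIntegral.integral_congr fun r hr => ?_
      rw [Set.uIcc_of_ge h] at hr
      rw [hneg r hr.2]
      ring_nf
    have h2 : 0 ≤ -∫ q in s..t, k q := by rw [← hneg t h]; exact abs_nonneg _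
    have h3 := Real.one_le_exp (x := -2 * ∫ q in s..t, k q) (by linarith)
    rw [h1, intervalIntegral.integral_const_mul, (key (-2)).integral_eq_sub, hneg t h,
      intervalIntegral.integral_same, mul_zero, Real.exp_zero, abs_of_nonpos (by linarith),
      show 2 * -(∫ q in s..t, k q) = -2 * ∫ q in s..t, k q by ring]
    linarith

/-- Picard iteration in the norm weighted by `W = exp (2 |∫ k|)`, which is contracting on all of `ℝ`
at once, so no local solutions have to be glued. The unknown is `v = u / W`, an ordinary bounded
continuous function. -/
theorem exists_solution (hF : IsCaratheodoryLipschitz F k) (s : ℝ) (x : Phase n) :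
    ∃ u : ℝ → Phase n, IsSolution F u ∧ u s = x := by
  set W : ℝ → ℝ := fun t => Real.exp (2 * |∫ q in s..t, k q|) with hW
  have hWc : Continuous W := Real.continuous_exp.comp (continuous_const.mul
    (intervalIntegral.continuous_primitive hF.integrable s).abs)
  have hW0 : ∀ t, 0 < W t := fun t => Real.exp_pos _
  have hW1 : ∀ t, 1 ≤ W t := fun t => Real.one_le_exp (by positivity)
  have hcont : ∀ v : BoundedContinuousFunction ℝ (Phase n), Continuous fun r => W r • v r :=
    fun v => hWc.smul v.continuous
  have hint := fun v : BoundedContinuousFunction ℝ (Phase n) => hF.intervalIntegrable (hcont v)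
  have hdiff : ∀ v w : BoundedContinuousFunction ℝ (Phase n), ∀ t,
      ‖(∫ r in s..t, F r (W r • v r)) - ∫ r in s..t, F r (W r • w r)‖
        ≤ W t / 2 * ‖v - w‖ := fun v w t => by
    rw [← intervalIntegral.integral_sub (hint v s t) (hint w s t)]
    refine (intervalIntegral.norm_integral_le_abs_of_norm_le (g := fun r => k r * W r * ‖v - w‖)
      (Eventually.of_forall fun r => ?_) (((hF.integrable s t).mul_continuousOn
        hWc.continuousOn).mul_const _)).trans ?_
    · refine (hF.lipschitz r _ _).trans ?_
      rw [← smul_sub, norm_smul, Real.norm_of_nonneg (hW0 r).le, mul_assoc]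
      exact mul_le_mul_of_nonneg_left (mul_le_mul_of_nonneg_left
        ((v - w).norm_coe_le_norm r) (hW0 r).le) (hF.nonneg r)
    · rw [intervalIntegral.integral_mul_const, abs_mul, abs_norm]
      exact mul_le_mul_of_nonneg_right (abs_integral_mul_exp_le hF.integrable hF.nonneg s t)
        (norm_nonneg _)
  let T : BoundedContinuousFunction ℝ (Phase n) → BoundedContinuousFunction ℝ (Phase n) :=
    fun v => BoundedContinuousFunction.ofNormedAddCommGroup
      (fun t => (W t)⁻¹ • (x + ∫ r in s..t, F r (W r • v r)))
      ((hWc.inv₀ fun t => (hW0 t).ne').smul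
        (continuous_const.add (intervalIntegral.continuous_primitive (hint v) s)))
      (‖x‖ + ‖v‖ / 2) (fun t => by
        have h0 := hdiff v 0 t
        simp only [BoundedContinuousFunction.coe_zero, Pi.zero_apply, smul_zero, hF.map_zero,
          intervalIntegral.integral_zero, sub_zero] at h0
        rw [norm_smul, norm_inv, Real.norm_of_nonneg (hW0 t).le, inv_mul_le_iff₀ (hW0 t)]
        refine (norm_add_le_of_le le_rfl h0).trans ?_
        nlinarith [hW1 t, norm_nonneg x, norm_nonneg v])
  obtain ⟨v, hv⟩ := exists_fixedPoint_of_norm_sub_le (T := T) (q := 1 / 2) (by norm_num)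
    fun v w => by
      refine (BoundedContinuousFunction.norm_le (by positivity)).mpr fun t => ?_
      change ‖(W t)⁻¹ • (x + ∫ r in s..t, F r (W r • v r))
        - (W t)⁻¹ • (x + ∫ r in s..t, F r (W r • w r))‖ ≤ _
      rw [← smul_sub, add_sub_add_left_eq_sub, norm_smul, norm_inv,
        Real.norm_of_nonneg (hW0 t).le, inv_mul_le_iff₀ (hW0 t)]
      refine (hdiff v w t).trans (le_of_eq ?_)
      ring
  have hfix : ∀ t, W t • v t = x + ∫ r in s..t, F r (W r • v r) := fun t => by
    have h1 : v t = (W t)⁻¹ • (x + ∫ r in s..t, F r (W r • v r)) := by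
      conv_lhs => rw [← hv]
      rfl
    conv_lhs => rw [h1]
    exact smul_inv_smul₀ (hW0 t).ne' _
  have hs : W s • v s = x := by rw [hfix s]; simp
  refine ⟨fun t => W t • v t, IsPrimitive.isSolution (.of_base (hint v) s fun t => ?_), hs⟩
  rw [hs]; exact hfix t

/-- The flow from time `0` of a Carathéodory–Lipschitz vector field. -/
theorem exists_flow (hF : IsCaratheodoryLipschitz F k) :
    ∃ Φ : ℝ → Phase n ≃ₜ Phase n, (∀ x, Φ 0 x = x) ∧ (∀ t, Φ t 0 = 0) ∧
      ∀ u : ℝ → Phase n, IsSolution F u ↔ ∀ t, u t = Φ t (u 0) := by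
  choose sol hsol hval using hF.exists_solution
  have hcont : ∀ s t, Continuous fun x => sol s x t := fun s t => by
    obtain ⟨C, hC⟩ := hF.exists_norm_sub_le s t
    refine continuous_of_norm_sub_le (C := C) fun x y => ?_
    simpa [hval] using hC _ _ (hsol s x) (hsol s y)
  have hinv : ∀ s t x, sol t (sol s x t) s = x := fun s t x => by
    rw [hF.eq_of_eq (hsol t (sol s x t)) (hsol s x) (s := t) (hval _ _), hval]
  have hzero : IsSolution F fun _ => (0 : Phase n) :=
    ⟨continuous_const, fun s t => by simp [hF.map_zero], fun s t => by simp [hF.map_zero]⟩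
  refine ⟨fun t => ⟨⟨fun x => sol 0 x t, fun x => sol t x 0, fun x => hinv 0 t x,
    fun x => hinv t 0 x⟩, hcont 0 t, hcont t 0⟩, fun x => hval 0 x, fun t => ?_, fun u => ?_⟩
  · exact hF.eq_of_eq (hsol 0 0) hzero (hval 0 0) t
  · refine ⟨fun hu t => hF.eq_of_eq hu (hsol 0 (u 0)) (hval _ _).symm t, fun h => ?_⟩
    have : u = sol 0 (u 0) := funext h
    rw [this]
    exact hsol _ _

end IsCaratheodoryLipschitz

end Caratheodory

/-! ### The linear equation and variation of constants -/

theorem intervalIntegrable_clm_comp {E F G : Type*} [NormedAddCommGroup E] [NormedSpace ℝ E]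
    [NormedAddCommGroup F] [NormedSpace ℝ F] [NormedAddCommGroup G] [NormedSpace ℝ G]
    {V : ℝ → F →L[ℝ] G} {U : ℝ → E →L[ℝ] F} (hV : ∀ a b, IntervalIntegrable V volume a b)
    (hU : Continuous U) (a b : ℝ) :
    IntervalIntegrable (fun t => (V t).comp (U t)) volume a b :=
  intervalIntegrable_clm_apply (V := fun t => ContinuousLinearMap.compL ℝ E F G (V t))
    (fun a b => ⟨ContinuousLinearMap.integrable_comp _ (hV a b).1,
      ContinuousLinearMap.integrable_comp _ (hV a b).2⟩) hU a b

section LinearEquation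

variable {n : ℕ} {A : ℝ → Phase n →L[ℝ] Phase n} {Ψ : ℝ → ℝ → Phase n →L[ℝ] Phase n}

theorem isCaratheodoryLipschitz_linear (hA : LocallyIntegrable A volume) :
    IsCaratheodoryLipschitz (fun t x => A t x) (fun t => ‖A t‖) where
  integrable a b := (intervalIntegrable_of_locallyIntegrable hA a b).norm
  nonneg t := norm_nonneg _
  measurable x := (ContinuousLinearMap.apply ℝ (Phase n) x).continuous.comp_aestronglyMeasurable
    hA.aestronglyMeasurable
  map_zero t := map_zero _
  lipschitz t x y := by rw [← map_sub]; exact (A t).le_opNorm _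

namespace IsEvolutionOperator

theorem self (hΨ : IsEvolutionOperator A Ψ) (s : ℝ) : Ψ s s = ContinuousLinearMap.id ℝ _ := by
  rw [hΨ.eq_integral s s]; simp

theorem isPrimitive (hΨ : IsEvolutionOperator A Ψ) (hA : LocallyIntegrable A volume) (s : ℝ) :
    IsPrimitive (fun r => (A r).comp (Ψ r s)) (fun t => Ψ t s) := by
  refine .of_base (fun a b => intervalIntegrable_clm_comp
    (intervalIntegrable_of_locallyIntegrable hA) (hΨ.continuous s) a b) s fun t => ?_
  rw [hΨ.self s]
  exact hΨ.eq_integral s t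

theorem isSolution (hΨ : IsEvolutionOperator A Ψ) (hA : LocallyIntegrable A volume) (s : ℝ)
    (x : Phase n) : IsSolution (fun t x => A t x) (fun t => Ψ t s x) :=
  IsPrimitive.isSolution
    ((hΨ.isPrimitive hA s).clm (ContinuousLinearMap.apply ℝ (Phase n) x))

theorem apply_apply (hΨ : IsEvolutionOperator A Ψ) (hA : LocallyIntegrable A volume)
    (t s r : ℝ) (x : Phase n) : Ψ t s (Ψ s r x) = Ψ t r x :=
  (isCaratheodoryLipschitz_linear hA).eq_of_eq (hΨ.isSolution hA s (Ψ s r x))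
    (hΨ.isSolution hA r x) (s := s) (by simp [hΨ.self]) t

theorem apply_apply_self (hΨ : IsEvolutionOperator A Ψ) (hA : LocallyIntegrable A volume)
    (t s : ℝ) (x : Phase n) : Ψ t s (Ψ s t x) = x := by
  rw [hΨ.apply_apply hA, hΨ.self]; rfl

/-- `Ψ s t` is the inverse of `Ψ t s`, and inversion is continuous on invertible operators. -/
theorem continuous_right (hΨ : IsEvolutionOperator A Ψ) (hA : LocallyIntegrable A volume)
    (s : ℝ) : Continuous fun t => Ψ s t := by
  let U : ℝ → (Phase n →L[ℝ] Phase n)ˣ := fun t =>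
    ⟨Ψ t s, Ψ s t, ContinuousLinearMap.ext (hΨ.apply_apply_self hA t s),
      ContinuousLinearMap.ext (hΨ.apply_apply_self hA s t)⟩
  have h : (fun t => Ψ s t) = fun t => Ring.inverse (Ψ t s) :=
    funext fun t => (Ring.inverse_unit (U t)).symm
  rw [h]
  exact continuous_iff_continuousAt.mpr fun t =>
    ContinuousAt.comp (g := Ring.inverse) (f := fun t => Ψ t s)
      (NormedRing.inverse_continuousAt (U t)) (hΨ.continuous s).continuousAt

/-- The variation of constants formula. -/
theorem isSolution_add_iff (hΨ : IsEvolutionOperator A Ψ) (hA : LocallyIntegrable A volume)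
    {h : ℝ → Phase n → Phase n} {u : ℝ → Phase n} :
    IsSolution (fun t x => A t x + h t x) u ↔
      IsPrimitive (fun r => Ψ 0 r (h r (u r))) (fun t => Ψ 0 t (u t)) := by
  constructor
  · intro hu
    have hAu : ∀ a b, IntervalIntegrable (fun r => A r (u r)) volume a b :=
      intervalIntegrable_clm_apply (intervalIntegrable_of_locallyIntegrable hA) hu.continuous
    have hg : ∀ a b, IntervalIntegrable (fun r => h r (u r)) volume a b := fun a b => by
      simpa using (hu.integrable a b).sub (hAu a b)
    have hZ := isPrimitive_integral ((isPrimitive_integral hg 0 0).intervalIntegrable_apply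
      (hΨ.continuous_right hA 0)) 0 (u 0)
    -- The difference between the Duhamel expression and `u` solves the homogeneous equation and
    -- vanishes at `0`, so it is zero.
    have hd := ((hΨ.isPrimitive hA 0).clm_apply hZ).sub hu.isPrimitive
    simp only [hΨ.apply_apply_self hA, ContinuousLinearMap.comp_apply,
      add_sub_add_right_eq_sub, ← map_sub] at hd
    have hd' : IsSolution (fun t x => A t x) _ := IsPrimitive.isSolution hd
    have h0 : IsSolution (fun t x => A t x) fun _ => (0 : Phase n) :=
      ⟨continuous_const, fun s t => by simp, fun s t => by simp⟩
    have heq : ∀ t, Ψ 0 t (u t) = u 0 + ∫ r in (0 : ℝ)..t, Ψ 0 r (h r (u r)) := fun t => by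
      have := (isCaratheodoryLipschitz_linear hA).eq_of_eq hd' h0 (s := 0) (by simp [hΨ.self]) t
      rw [← sub_eq_zero.mp this, hΨ.apply_apply_self hA]
    simpa only [heq] using hZ
  · intro hZ
    refine IsPrimitive.isSolution ?_
    simpa only [hΨ.apply_apply_self hA, ContinuousLinearMap.comp_apply] using
      (hΨ.isPrimitive hA 0).clm_apply hZ

end IsEvolutionOperator

end LinearEquation

/-! ### Calculus of growth rates -/

/-- A nonnegative derivative that exists everywhere is automatically locally integrable. This is
what allows `μ` to be merely differentiable, with no continuity of `deriv μ`. -/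
theorem IsPrimitive.of_hasDerivAt_of_nonneg {h H : ℝ → ℝ} (hd : ∀ t, HasDerivAt H (h t) t)
    (h0 : ∀ t, 0 ≤ h t) : IsPrimitive h H := by
  have hi : ∀ a b, IntervalIntegrable h volume a b := fun a b =>
    intervalIntegral.intervalIntegrable_deriv_of_nonneg
      (fun t _ => (hd t).continuousAt.continuousWithinAt) (fun t _ => hd t) fun t _ => h0 t
  refine ⟨hi, fun a b => ?_⟩
  rw [intervalIntegral.integral_eq_sub_of_hasDerivAt (fun t _ => hd t) (hi a b)]
  ring

namespace IsDifferentiableGrowthRate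

variable {μ : ℝ → ℝ}

theorem deriv_nonneg (hμ : IsDifferentiableGrowthRate μ) (t : ℝ) : 0 ≤ deriv μ t :=
  hμ.strictMono.monotone.deriv_nonneg

theorem one_le (hμ : IsDifferentiableGrowthRate μ) {t : ℝ} (ht : 0 ≤ t) : 1 ≤ μ t :=
  hμ.map_zero ▸ hμ.strictMono.monotone ht

theorem le_one (hμ : IsDifferentiableGrowthRate μ) {t : ℝ} (ht : t ≤ 0) : μ t ≤ 1 :=
  hμ.map_zero ▸ hμ.strictMono.monotone ht

theorem hasDerivAt_rpow (hμ : IsDifferentiableGrowthRate μ) {c : ℝ} (hc : c ≠ 0) (t : ℝ) :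
    HasDerivAt (fun t => μ t ^ c / c) (μ t ^ (c - 1) * deriv μ t) t := by
  have := ((hμ.differentiable t).hasDerivAt.rpow_const (p := c) (Or.inl (hμ.pos t).ne')).div_const c
  rwa [mul_right_comm, mul_div_cancel_right₀ _ hc, mul_comm] at this

theorem rpow_mul_deriv_nonneg (hμ : IsDifferentiableGrowthRate μ) (c t : ℝ) :
    0 ≤ μ t ^ c * deriv μ t :=
  mul_nonneg (Real.rpow_nonneg (hμ.pos t).le _) (hμ.deriv_nonneg t)

theorem isPrimitive_rpow (hμ : IsDifferentiableGrowthRate μ) {c : ℝ} (hc : c ≠ 0) :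
    IsPrimitive (fun t => μ t ^ (c - 1) * deriv μ t) (fun t => μ t ^ c / c) :=
  .of_hasDerivAt_of_nonneg (hμ.hasDerivAt_rpow hc) (hμ.rpow_mul_deriv_nonneg _)

theorem isPrimitive_log (hμ : IsDifferentiableGrowthRate μ) :
    IsPrimitive (fun t => (μ t)⁻¹ * deriv μ t) (fun t => Real.log (μ t)) := by
  refine .of_hasDerivAt_of_nonneg (fun t => ?_) fun t =>
    mul_nonneg (inv_nonneg.mpr (hμ.pos t).le) (hμ.deriv_nonneg t)
  convert (hμ.differentiable t).hasDerivAt.log (hμ.pos t).ne' using 1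
  ring

theorem rpow_sign_mul_le_one (hμ : IsDifferentiableGrowthRate μ) {c : ℝ} (hc : c ≤ 0) (t : ℝ) :
    μ t ^ (Real.sign t * c) ≤ 1 := by
  rcases lt_trichotomy t 0 with ht | rfl | ht
  · rw [Real.sign_of_neg ht]
    exact Real.rpow_le_one (hμ.pos t).le (hμ.le_one ht.le) (by linarith)
  · simp
  · rw [Real.sign_of_pos ht]
    exact Real.rpow_le_one_of_one_le_of_nonpos (hμ.one_le ht.le) (by linarith)

theorem lipWeight_nonneg (hμ : IsDifferentiableGrowthRate μ) {δ : ℝ} (hδ : 0 ≤ δ) (θ t : ℝ) :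
    0 ≤ lipWeight μ θ δ t :=
  mul_nonneg (mul_nonneg hδ (Real.rpow_nonneg (hμ.pos t).le _)) (hμ.deriv_nonneg t)

/-- The nonuniformity of the dichotomy is absorbed by the Lipschitz weight. -/
theorem rpow_mul_lipWeight_le (hμ : IsDifferentiableGrowthRate μ) {δ θ ν : ℝ} (hδ : 0 ≤ δ)
    (hν : ν ≤ θ) (c t r : ℝ) :
    (μ t / μ r) ^ c * μ r ^ (Real.sign r * ν) * lipWeight μ θ δ r
      ≤ δ * (μ t ^ c * (μ r ^ (-c - 1) * deriv μ r)) := by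
  have hr := hμ.pos r
  -- Collecting exponents leaves the surplus factor `μ r ^ (sign r * (ν - θ))`, which is at most `1`
  -- because `ν ≤ θ`.
  have h1 : (μ t / μ r) ^ c * μ r ^ (Real.sign r * ν) * lipWeight μ θ δ r
      = δ * (μ t ^ c * (μ r ^ (-c - 1) * deriv μ r)) * μ r ^ (Real.sign r * (ν - θ)) := by
    have e : μ r ^ (-c) * (μ r ^ (Real.sign r * ν) * μ r ^ (-1 - Real.sign r * θ))
        = μ r ^ (-c - 1) * μ r ^ (Real.sign r * (ν - θ)) := by
      rw [← Real.rpow_add hr, ← Real.rpow_add hr, ← Real.rpow_add hr]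
      ring_nf
    rw [lipWeight, Real.div_rpow (hμ.pos t).le hr.le, div_eq_mul_inv, ← Real.rpow_neg hr.le]
    linear_combination δ * μ t ^ c * deriv μ r * e
  rw [h1]
  exact mul_le_of_le_one_right (mul_nonneg hδ (mul_nonneg (Real.rpow_nonneg (hμ.pos t).le _)
    (hμ.rpow_mul_deriv_nonneg _ _))) (hμ.rpow_sign_mul_le_one (by linarith) r)

/-- Replaces the weight, whose exponent jumps at `0`, by the sum of its two branches: a continuous
function times `deriv μ`, hence visibly locally integrable. -/
theorem lipWeight_le (hμ : IsDifferentiableGrowthRate μ) {δ : ℝ} (hδ : 0 ≤ δ) (θ t : ℝ) :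
    lipWeight μ θ δ t ≤ δ * (μ t ^ (-1 - θ) + μ t ^ (-1 + θ)) * deriv μ t := by
  have h1 := Real.rpow_nonneg (hμ.pos t).le (-1 - θ)
  have h2 := Real.rpow_nonneg (hμ.pos t).le (-1 + θ)
  refine mul_le_mul_of_nonneg_right (mul_le_mul_of_nonneg_left ?_ hδ) (hμ.deriv_nonneg t)
  rcases lt_trichotomy t 0 with ht | rfl | ht
  · rw [Real.sign_of_neg ht, neg_one_mul, sub_neg_eq_add]
    linarith
  · simp [hμ.map_zero]
  · rw [Real.sign_of_pos ht, one_mul]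
    linarith

theorem intervalIntegrable_lipWeight_bound (hμ : IsDifferentiableGrowthRate μ) (δ θ a b : ℝ) :
    IntervalIntegrable (fun t => δ * (μ t ^ (-1 - θ) + μ t ^ (-1 + θ)) * deriv μ t)
      volume a b := by
  have hc : ∀ c : ℝ, Continuous fun t => μ t ^ c := fun c =>
    hμ.differentiable.continuous.rpow_const fun t => Or.inl (hμ.pos t).ne'
  have hd := (hμ.isPrimitive_rpow one_ne_zero).integrable a b
  simp only [sub_self, Real.rpow_zero, one_mul] at hd
  exact hd.continuousOn_mul (continuous_const.mul ((hc _).add (hc _))).continuousOn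

/-- Reflecting time makes `μ` decreasing; taking the reciprocal restores a growth rate, and
`lipWeight_reverse` shows that the Lipschitz weight is merely reflected. -/
theorem reverse (hμ : IsDifferentiableGrowthRate μ) :
    IsDifferentiableGrowthRate fun t => (μ (-t))⁻¹ where
  pos t := inv_pos.mpr (hμ.pos _)
  strictMono s t hst := (inv_lt_inv₀ (hμ.pos _) (hμ.pos _)).mpr (hμ.strictMono (neg_lt_neg hst))
  map_zero := by simp [hμ.map_zero]
  tendsto_atTop := by
    refine Tendsto.inv_tendsto_nhdsGT_zero ?_
    exact tendsto_nhdsWithin_iff.mpr ⟨hμ.tendsto_atBot.comp tendsto_neg_atTop_atBot,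
      Eventually.of_forall fun t => hμ.pos _⟩
  tendsto_atBot := (hμ.tendsto_atTop.comp tendsto_neg_atBot_atTop).inv_tendsto_atTop
  differentiable := (hμ.differentiable.comp differentiable_neg).inv fun t => (hμ.pos _).ne'

theorem lipWeight_reverse (hμ : IsDifferentiableGrowthRate μ) (θ δ t : ℝ) :
    lipWeight (fun t => (μ (-t))⁻¹) θ δ t = lipWeight μ θ δ (-t) := by
  have hd : deriv (fun t => (μ (-t))⁻¹) t = (μ (-t)) ^ (-2 : ℝ) * deriv μ (-t) := by
    have h1 : HasDerivAt (fun t => μ (-t)) (deriv μ (-t) * -1) t :=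
      (hμ.differentiable (-t)).hasDerivAt.comp t (hasDerivAt_neg t)
    rw [(h1.fun_inv (hμ.pos _).ne').deriv, Real.rpow_neg (hμ.pos _).le, Real.rpow_two]
    field_simp
  have e : ((μ (-t))⁻¹) ^ (-1 - Real.sign t * θ) * μ (-t) ^ (-2 : ℝ)
      = μ (-t) ^ (-1 - Real.sign (-t) * θ) := by
    rw [Real.inv_rpow (hμ.pos _).le, ← Real.rpow_neg (hμ.pos _).le, ← Real.rpow_add (hμ.pos _),
      Real.sign_neg]
    ring_nf
  rw [lipWeight, lipWeight, hd, ← e]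
  ring

end IsDifferentiableGrowthRate

/-! ### Sums and linear conjugates of Carathéodory–Lipschitz fields -/

section Fields

variable {n : ℕ} {F G : ℝ → Phase n → Phase n} {k l : ℝ → ℝ}

theorem IsCaratheodoryLipschitz.add (hF : IsCaratheodoryLipschitz F k)
    (hG : IsCaratheodoryLipschitz G l) :
    IsCaratheodoryLipschitz (fun t x => F t x + G t x) (fun t => k t + l t) where
  integrable a b := (hF.integrable a b).add (hG.integrable a b)
  nonneg t := add_nonneg (hF.nonneg t) (hG.nonneg t)
  measurable x := (hF.measurable x).add (hG.measurable x)
  map_zero t := by simp [hF.map_zero, hG.map_zero]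
  lipschitz t x y := by
    rw [add_sub_add_comm, add_mul]
    exact norm_add_le_of_le (hF.lipschitz t x y) (hG.lipschitz t x y)

theorem IsCaratheodoryLipschitz.comp_clm (hF : IsCaratheodoryLipschitz F k)
    {B C : ℝ → Phase n →L[ℝ] Phase n} (hB : Continuous B) (hC : Continuous C) :
    IsCaratheodoryLipschitz (fun t x => B t (F t (C t x))) (fun t => ‖B t‖ * ‖C t‖ * k t) where
  integrable a b := (hF.integrable a b).continuousOn_mul (hB.norm.mul hC.norm).continuousOn
  nonneg t := mul_nonneg (mul_nonneg (norm_nonneg _) (norm_nonneg _)) (hF.nonneg t)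
  measurable x := ContinuousLinearMap.aestronglyMeasurable_comp₂
      (ContinuousLinearMap.id ℝ (Phase n →L[ℝ] Phase n)) hB.aestronglyMeasurable
      (aestronglyMeasurable_superposition hF.measurable hF.continuous
        (hC.clm_apply continuous_const))
  map_zero t := by simp [hF.map_zero]
  lipschitz t x y := by
    rw [← map_sub]
    calc _ ≤ ‖B t‖ * (k t * (‖C t‖ * ‖x - y‖)) := by
          refine (B t).le_opNorm_of_le ((hF.lipschitz t _ _).trans ?_)
          rw [← map_sub]
          exact mul_le_mul_of_nonneg_left ((C t).le_opNorm _) (hF.nonneg t)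
      _ = _ := by ring

end Fields

/-- A small Lipschitz perturbation of a linear equation admitting a nonuniform dichotomy. -/
structure PerturbedDichotomy {n : ℕ} (μ : ℝ → ℝ) (A : ℝ → Phase n →L[ℝ] Phase n)
    (Ψ : ℝ → ℝ → Phase n →L[ℝ] Phase n) (π : ℝ → Phase n →L[ℝ] Phase n)
    (f : ℝ → Phase n → Phase n) (D lamS lamU ν ω θ δ : ℝ) : Prop where
  growth : IsDifferentiableGrowthRate μ
  locallyIntegrable : LocallyIntegrable A volume
  evolution : IsEvolutionOperator A Ψ
  dichotomy : HasNonuniformDichotomy μ Ψ π D lamS lamU ν ω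
  nu_le : ν ≤ θ
  omega_le : ω ≤ θ
  delta_pos : 0 < δ
  small_stable : 8 * D ^ 3 * δ < -lamS
  small_unstable : 8 * D ^ 3 * δ < lamU
  perturbation : IsAdmissiblePerturbation (lipWeight μ θ δ) f

/-! ### Perturbed dichotomies: time reversal, projections, kernel bounds -/

namespace PerturbedDichotomy

variable {n : ℕ} {μ : ℝ → ℝ} {A : ℝ → Phase n →L[ℝ] Phase n}
  {Ψ : ℝ → ℝ → Phase n →L[ℝ] Phase n} {π : ℝ → Phase n →L[ℝ] Phase n}
  {f : ℝ → Phase n → Phase n} {D lamS lamU ν ω θ δ : ℝ}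

/-- The symmetry that reduces unstable statements to stable ones: the complementary projections
trade places, as do `lamS` with `-lamU` and `ν` with `ω`, while `D`, `θ` and `δ` are unchanged. -/
theorem reverse (h : PerturbedDichotomy μ A Ψ π f D lamS lamU ν ω θ δ) :
    PerturbedDichotomy (fun t => (μ (-t))⁻¹) (fun t => -A (-t)) (fun t s => Ψ (-t) (-s))
      (fun t => coProj π (-t)) (reverseField f) D (-lamU) (-lamS) ω ν θ δ where
  growth := h.growth.reverse
  locallyIntegrable := by
    refine locallyIntegrable_of_intervalIntegrable fun a b => ?_
    have := (IntervalIntegrable.iff_comp_neg (f := A) (a := -a) (b := -b)).mp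
      (intervalIntegrable_of_locallyIntegrable h.locallyIntegrable (-a) (-b))
    rw [neg_neg, neg_neg] at this
    exact this.neg
  evolution := by
    refine ⟨fun s => (h.evolution.continuous (-s)).comp continuous_neg, fun s t => ?_⟩
    have := (h.evolution.isPrimitive h.locallyIntegrable (-s)).comp_neg.eq_integral s t
    rw [h.evolution.self] at this
    simpa using this
  dichotomy := by
    have hd := h.dichotomy
    have hμ := h.growth.pos
    have hb : ∀ t s c e : ℝ, ((μ (-t))⁻¹ / (μ (-s))⁻¹) ^ (-c) * ((μ (-s))⁻¹) ^ (Real.sign s * e)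
        = (μ (-t) / μ (-s)) ^ c * μ (-s) ^ (Real.sign (-s) * e) := fun t s c e => by
      rw [← inv_div_inv, inv_inv, inv_inv, Real.inv_rpow (hμ _).le, ← Real.rpow_neg (hμ _).le,
        Real.sign_neg, neg_mul, ← inv_div, Real.inv_rpow (div_pos (hμ _) (hμ _)).le,
        ← Real.rpow_neg (div_pos (hμ _) (hμ _)).le, neg_neg]
    have hco : ∀ s, ContinuousLinearMap.id ℝ (Phase n) - coProj π s = π s := fun s => by
      rw [coProj, sub_sub_cancel]
    exact {
      one_le := hd.one_le
      lamS_neg := neg_neg_of_pos hd.lamU_pos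
      lamU_pos := neg_pos_of_neg hd.lamS_neg
      nu_nonneg := hd.omega_nonneg
      omega_nonneg := hd.nu_nonneg
      stable_gap := by linarith [hd.unstable_gap]
      unstable_gap := by linarith [hd.stable_gap]
      proj := fun t => by
        ext1 x
        have := DFunLike.congr_fun (hd.proj (-t)) x
        simp only [ContinuousLinearMap.comp_apply] at this
        simp [coProj, this]
      comm := fun t s => by
        ext1 x
        have := DFunLike.congr_fun (hd.comm (-t) (-s)) x
        simp only [ContinuousLinearMap.comp_apply] at this
        simp [coProj, this]
      stable_bound := fun t s hst => by
        rw [mul_assoc, hb, ← mul_assoc]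
        exact hd.unstable_bound (-t) (-s) (neg_le_neg hst)
      unstable_bound := fun t s hst => by
        rw [mul_assoc, hb, ← mul_assoc, hco]
        exact hd.stable_bound (-t) (-s) (neg_le_neg hst) }
  nu_le := h.omega_le
  omega_le := h.nu_le
  delta_pos := h.delta_pos
  small_stable := by rw [neg_neg]; exact h.small_unstable
  small_unstable := h.small_stable
  perturbation := by
    have hf := h.perturbation
    have hq := (Measure.measurePreserving_neg (volume : Measure ℝ)).quasiMeasurePreserving
    refine ⟨?_, fun x => ?_, fun t => ?_, fun t x y => ?_⟩
    · filter_upwards [hq.ae hf.continuous] with t ht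
      exact ht.neg
    · exact ((hf.measurable x).comp_quasiMeasurePreserving hq).neg
    · simp [reverseField, hf.map_zero]
    · rw [h.growth.lipWeight_reverse, reverseField, reverseField, ← norm_neg, neg_sub_neg,
        neg_sub]
      exact hf.lipschitz (-t) x y

theorem proj_apply_self (h : PerturbedDichotomy μ A Ψ π f D lamS lamU ν ω θ δ) (t : ℝ)
    (x : Phase n) : π t (π t x) = π t x :=
  DFunLike.congr_fun (h.dichotomy.proj t) x

theorem proj_evolution (h : PerturbedDichotomy μ A Ψ π f D lamS lamU ν ω θ δ) (t s : ℝ)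
    (x : Phase n) : π t (Ψ t s x) = Ψ t s (π s x) :=
  DFunLike.congr_fun (h.dichotomy.comm t s) x

theorem coProj_evolution (h : PerturbedDichotomy μ A Ψ π f D lamS lamU ν ω θ δ) (t s : ℝ)
    (x : Phase n) : coProj π t (Ψ t s x) = Ψ t s (coProj π s x) := by
  simp [coProj, h.proj_evolution]

theorem coProj_apply_self (h : PerturbedDichotomy μ A Ψ π f D lamS lamU ν ω θ δ) (t : ℝ)
    (x : Phase n) : coProj π t (coProj π t x) = coProj π t x := by
  simp [coProj, h.proj_apply_self]

theorem proj_coProj (h : PerturbedDichotomy μ A Ψ π f D lamS lamU ν ω θ δ) (t : ℝ)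
    (x : Phase n) : π t (coProj π t x) = 0 := by
  simp [coProj, h.proj_apply_self]

theorem coProj_proj (h : PerturbedDichotomy μ A Ψ π f D lamS lamU ν ω θ δ) (t : ℝ)
    (x : Phase n) : coProj π t (π t x) = 0 := by
  simp [coProj, h.proj_apply_self]

theorem proj_add_coProj (π : ℝ → Phase n →L[ℝ] Phase n) (t : ℝ) (x : Phase n) :
    π t x + coProj π t x = x := by
  simp [coProj]

/-- Continuity is not assumed: commutation with the evolution operator forces `π t = Ψ t 0 ∘ π 0 ∘ Ψ
0 t`. -/
theorem continuous_proj (h : PerturbedDichotomy μ A Ψ π f D lamS lamU ν ω θ δ) :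
    Continuous π := by
  have : π = fun t => (Ψ t 0).comp ((π 0).comp (Ψ 0 t)) := by
    funext t
    ext1 x
    simp [← h.proj_evolution, h.evolution.apply_apply_self h.locallyIntegrable]
  rw [this]
  exact (h.evolution.continuous 0).clm_comp
    (continuous_const.clm_comp (h.evolution.continuous_right h.locallyIntegrable 0))

theorem continuous_coProj (h : PerturbedDichotomy μ A Ψ π f D lamS lamU ν ω θ δ) :
    Continuous (coProj π) :=
  continuous_const.sub h.continuous_proj

theorem norm_proj_zero_le (h : PerturbedDichotomy μ A Ψ π f D lamS lamU ν ω θ δ) :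
    ‖π 0‖ ≤ D := by
  simpa [h.evolution.self, h.growth.map_zero] using h.dichotomy.stable_bound 0 0 le_rfl

theorem norm_coProj_zero_le (h : PerturbedDichotomy μ A Ψ π f D lamS lamU ν ω θ δ) :
    ‖coProj π 0‖ ≤ D := by
  simpa [coProj, h.evolution.self, h.growth.map_zero] using h.dichotomy.unstable_bound 0 0 le_rfl

/-- Pointwise bound for the stable part of the variation of constants kernel. -/
theorem norm_evolution_proj_le (h : PerturbedDichotomy μ A Ψ π f D lamS lamU ν ω θ δ)
    {t r m : ℝ} (hr : r ≤ t) {x : Phase n} (hx : ‖x‖ ≤ lipWeight μ θ δ r * m) (hm : 0 ≤ m) :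
    ‖Ψ t r (π r x)‖ ≤ D * δ * m * (μ t ^ lamS * (μ r ^ (-lamS - 1) * deriv μ r)) := by
  have h1 := (((Ψ t r).comp (π r)).le_of_opNorm_le (h.dichotomy.stable_bound t r hr) x)
  have h2 := h.growth.rpow_mul_lipWeight_le h.delta_pos.le h.nu_le lamS t r
  have hD : 0 ≤ D := zero_le_one.trans h.dichotomy.one_le
  have hpos : 0 ≤ (μ t / μ r) ^ lamS * μ r ^ (Real.sign r * ν) :=
    mul_nonneg (Real.rpow_nonneg (div_pos (h.growth.pos _) (h.growth.pos _)).le _)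
      (Real.rpow_nonneg (h.growth.pos _).le _)
  calc ‖Ψ t r (π r x)‖ ≤ D * (μ t / μ r) ^ lamS * μ r ^ (Real.sign r * ν) * ‖x‖ := h1
    _ ≤ D * ((μ t / μ r) ^ lamS * μ r ^ (Real.sign r * ν)) * (lipWeight μ θ δ r * m) := by
        rw [mul_assoc D]
        exact mul_le_mul_of_nonneg_left hx (mul_nonneg hD hpos)
    _ = D * m * ((μ t / μ r) ^ lamS * μ r ^ (Real.sign r * ν) * lipWeight μ θ δ r) := by ring
    _ ≤ D * m * (δ * (μ t ^ lamS * (μ r ^ (-lamS - 1) * deriv μ r))) :=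
        mul_le_mul_of_nonneg_left h2 (mul_nonneg hD hm)
    _ = _ := by ring

/-- Pointwise bound for the unstable part of the variation of constants kernel. -/
theorem norm_evolution_coProj_le (h : PerturbedDichotomy μ A Ψ π f D lamS lamU ν ω θ δ)
    {t r m : ℝ} (hr : t ≤ r) {x : Phase n} (hx : ‖x‖ ≤ lipWeight μ θ δ r * m) (hm : 0 ≤ m) :
    ‖Ψ t r (coProj π r x)‖ ≤ D * δ * m * (μ t ^ lamU * (μ r ^ (-lamU - 1) * deriv μ r)) := by
  have h1 := (((Ψ t r).comp (coProj π r)).le_of_opNorm_le (h.dichotomy.unstable_bound t r hr) x)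
  have h2 := h.growth.rpow_mul_lipWeight_le h.delta_pos.le h.omega_le lamU t r
  have hD : 0 ≤ D := zero_le_one.trans h.dichotomy.one_le
  have hpos : 0 ≤ (μ t / μ r) ^ lamU * μ r ^ (Real.sign r * ω) :=
    mul_nonneg (Real.rpow_nonneg (div_pos (h.growth.pos _) (h.growth.pos _)).le _)
      (Real.rpow_nonneg (h.growth.pos _).le _)
  calc ‖Ψ t r (coProj π r x)‖ ≤ D * (μ t / μ r) ^ lamU * μ r ^ (Real.sign r * ω) * ‖x‖ := h1
    _ ≤ D * ((μ t / μ r) ^ lamU * μ r ^ (Real.sign r * ω)) * (lipWeight μ θ δ r * m) := by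
        rw [mul_assoc D]
        exact mul_le_mul_of_nonneg_left hx (mul_nonneg hD hpos)
    _ = D * m * ((μ t / μ r) ^ lamU * μ r ^ (Real.sign r * ω) * lipWeight μ θ δ r) := by ring
    _ ≤ D * m * (δ * (μ t ^ lamU * (μ r ^ (-lamU - 1) * deriv μ r))) :=
        mul_le_mul_of_nonneg_left h2 (mul_nonneg hD hm)
    _ = _ := by ring

theorem caratheodoryLipschitz_perturbation
    (h : PerturbedDichotomy μ A Ψ π f D lamS lamU ν ω θ δ) :
    IsCaratheodoryLipschitz f
      (fun t => δ * (μ t ^ (-1 - θ) + μ t ^ (-1 + θ)) * deriv μ t) where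
  integrable a b := h.growth.intervalIntegrable_lipWeight_bound δ θ a b
  nonneg t := mul_nonneg (mul_nonneg h.delta_pos.le
    (add_nonneg (Real.rpow_nonneg (h.growth.pos t).le _) (Real.rpow_nonneg (h.growth.pos t).le _)))
    (h.growth.deriv_nonneg t)
  measurable x := (h.perturbation.measurable x).aestronglyMeasurable
  map_zero := h.perturbation.map_zero
  lipschitz t x y := (h.perturbation.lipschitz t x y).trans
    (mul_le_mul_of_nonneg_right (h.growth.lipWeight_le h.delta_pos.le θ t) (norm_nonneg _))

theorem exists_caratheodoryLipschitz_full
    (h : PerturbedDichotomy μ A Ψ π f D lamS lamU ν ω θ δ) :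
    ∃ k, IsCaratheodoryLipschitz (fullField A f) k :=
  ⟨_, (isCaratheodoryLipschitz_linear h.locallyIntegrable).add
    h.caratheodoryLipschitz_perturbation⟩

theorem exists_caratheodoryLipschitz_stable
    (h : PerturbedDichotomy μ A Ψ π f D lamS lamU ν ω θ δ) :
    ∃ k, IsCaratheodoryLipschitz (stableField A π f) k :=
  ⟨_, (isCaratheodoryLipschitz_linear h.locallyIntegrable).add
    (h.caratheodoryLipschitz_perturbation.comp_clm h.continuous_proj
      (continuous_const (y := ContinuousLinearMap.id ℝ (Phase n))))⟩

theorem exists_caratheodoryLipschitz_unstable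
    (h : PerturbedDichotomy μ A Ψ π f D lamS lamU ν ω θ δ) :
    ∃ k, IsCaratheodoryLipschitz (unstableField A π f) k :=
  ⟨_, (isCaratheodoryLipschitz_linear h.locallyIntegrable).add
    (h.caratheodoryLipschitz_perturbation.comp_clm h.continuous_coProj
      (continuous_const (y := ContinuousLinearMap.id ℝ (Phase n))))⟩

end PerturbedDichotomy

/-! ### Contraction and expansion of the decoupled equations -/

namespace PerturbedDichotomy

variable {n : ℕ} {μ : ℝ → ℝ} {A : ℝ → Phase n →L[ℝ] Phase n}
  {Ψ : ℝ → ℝ → Phase n →L[ℝ] Phase n} {π : ℝ → Phase n →L[ℝ] Phase n}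
  {f : ℝ → Phase n → Phase n} {D lamS lamU ν ω θ δ : ℝ}

section Duhamel

variable {g w : ℝ → Phase n}

theorem isPrimitive_evolution (h : PerturbedDichotomy μ A Ψ π f D lamS lamU ν ω θ δ)
    (hw : IsPrimitive (fun r => Ψ 0 r (g r)) (fun r => Ψ 0 r (w r))) (t : ℝ) :
    IsPrimitive (fun r => Ψ t r (g r)) (fun r => Ψ t r (w r)) := by
  simpa only [h.evolution.apply_apply h.locallyIntegrable] using hw.clm (Ψ t 0)

theorem isPrimitive_evolution_proj (h : PerturbedDichotomy μ A Ψ π f D lamS lamU ν ω θ δ)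
    (hw : IsPrimitive (fun r => Ψ 0 r (g r)) (fun r => Ψ 0 r (w r))) (t : ℝ) :
    IsPrimitive (fun r => Ψ t r (π r (g r))) (fun r => Ψ t r (π r (w r))) := by
  simpa only [h.proj_evolution] using (h.isPrimitive_evolution hw t).clm (π t)

theorem isPrimitive_evolution_coProj (h : PerturbedDichotomy μ A Ψ π f D lamS lamU ν ω θ δ)
    (hw : IsPrimitive (fun r => Ψ 0 r (g r)) (fun r => Ψ 0 r (w r))) (t : ℝ) :
    IsPrimitive (fun r => Ψ t r (coProj π r (g r))) (fun r => Ψ t r (coProj π r (w r))) := by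
  simpa only [h.coProj_evolution] using (h.isPrimitive_evolution hw t).clm (coProj π t)

end Duhamel

theorem D_delta_le (h : PerturbedDichotomy μ A Ψ π f D lamS lamU ν ω θ δ) :
    D * δ ≤ D ^ 3 * δ :=
  mul_le_mul_of_nonneg_right (by nlinarith [h.dichotomy.one_le, sq_nonneg (D - 1)])
    h.delta_pos.le

theorem D_delta_pos (h : PerturbedDichotomy μ A Ψ π f D lamS lamU ν ω θ δ) : 0 < D * δ :=
  mul_pos (zero_lt_one.trans_le h.dichotomy.one_le) h.delta_pos

theorem stable_rate_neg (h : PerturbedDichotomy μ A Ψ π f D lamS lamU ν ω θ δ) :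
    lamS + D * δ < 0 := by
  nlinarith [h.D_delta_le, h.small_stable, h.D_delta_pos]

/-- Differences of solutions stay in the stable subspaces, so Duhamel's formula involves the stable
kernel only. After multiplication by `μ ^ (-lamS)` the kernel becomes `D * δ * μ' / μ`, whose
primitive is `D * δ * log μ`; Gronwall's exponential is therefore the power `(μ t / μ τ) ^ (D * δ)`.
-/
theorem contractsAtRate (h : PerturbedDichotomy μ A Ψ π f D lamS lamU ν ω θ δ) :
    ContractsAtRate μ (stableField A π f) (stableSubspace π) D (lamS + D * δ) ν := by
  intro u v hu hv huX hvX t τ hτt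
  have hμ := h.growth.pos
  have hw := ((h.evolution.isSolution_add_iff h.locallyIntegrable).mp hu).sub
    ((h.evolution.isSolution_add_iff h.locallyIntegrable).mp hv)
  simp only [← map_sub] at hw
  have hπ : ∀ r, π r (u r - v r) = u r - v r := fun r => by
    obtain ⟨x, hx⟩ := huX r
    obtain ⟨y, hy⟩ := hvX r
    rw [← hx, ← hy, map_sub, h.proj_apply_self, h.proj_apply_self]
  set C := D * μ τ ^ (Real.sign τ * ν) * μ τ ^ (-lamS) * ‖u τ - v τ‖ with hC
  have hwc : Continuous fun r => u r - v r := hu.continuous.sub hv.continuous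
  have hμc : ∀ c : ℝ, Continuous fun r => μ r ^ c := fun c =>
    h.growth.differentiable.continuous.rpow_const fun r => Or.inl (hμ r).ne'
  have hK : IsPrimitive (fun r => D * δ * ((μ r)⁻¹ * deriv μ r))
      (fun r => D * δ * Real.log (μ r)) := by
    simpa using h.growth.isPrimitive_log.clm ((D * δ) • ContinuousLinearMap.id ℝ ℝ)
  have hgr := gronwall_of_le_integral (g := fun r => μ r ^ (-lamS) * ‖u r - v r‖) (C := C)
    (s := τ) hK (fun r => mul_nonneg h.D_delta_pos.le (mul_nonneg (inv_nonneg.mpr (hμ r).le)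
      (h.growth.deriv_nonneg r))) ((hμc _).mul hwc.norm) (fun t hτt => ?_) t hτt
  · have hexp : Real.exp (D * δ * Real.log (μ t) - D * δ * Real.log (μ τ))
        = (μ t / μ τ) ^ (D * δ) := by
      rw [Real.rpow_def_of_pos (div_pos (hμ t) (hμ τ)), Real.log_div (hμ t).ne' (hμ τ).ne']
      ring_nf
    rw [hexp] at hgr
    have h1 : μ t ^ lamS * μ t ^ (-lamS) = 1 := by
      rw [← Real.rpow_add (hμ t), add_neg_cancel, Real.rpow_zero]
    calc ‖u t - v t‖ = μ t ^ lamS * (μ t ^ (-lamS) * ‖u t - v t‖) := by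
          rw [← mul_assoc, h1, one_mul]
      _ ≤ μ t ^ lamS * (C * (μ t / μ τ) ^ (D * δ)) :=
          mul_le_mul_of_nonneg_left hgr (Real.rpow_nonneg (hμ t).le _)
      _ = _ := by
          rw [hC, Real.rpow_add (div_pos (hμ t) (hμ τ)), Real.div_rpow (hμ t).le (hμ τ).le lamS,
            Real.rpow_neg (hμ τ).le]
          ring
  · have hP := h.isPrimitive_evolution hw t
    have heq := hP.eq_integral τ t
    rw [h.evolution.self, ContinuousLinearMap.id_apply, ← hπ τ] at heq
    have hb1 : ‖Ψ t τ (π τ (u τ - v τ))‖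
        ≤ D * (μ t / μ τ) ^ lamS * μ τ ^ (Real.sign τ * ν) * ‖u τ - v τ‖ :=
      ((Ψ t τ).comp (π τ)).le_of_opNorm_le (h.dichotomy.stable_bound t τ hτt) _
    have hb2 : ‖∫ r in τ..t, Ψ t r (π r (f r (u r) - f r (v r)))‖
        ≤ ∫ r in τ..t, D * δ * ‖u r - v r‖ * (μ t ^ lamS * (μ r ^ (-lamS - 1) * deriv μ r)) := by
      refine intervalIntegral.norm_integral_le_of_norm_le hτt
        (Eventually.of_forall fun r hr => h.norm_evolution_proj_le hr.2
          (h.perturbation.lipschitz r _ _) (norm_nonneg _)) ?_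
      exact ((h.growth.isPrimitive_rpow (neg_ne_zero.mpr h.dichotomy.lamS_neg.ne)).integrable
        τ t |>.const_mul _).continuousOn_mul (continuous_const.mul hwc.norm).continuousOn
    have h1 : μ t ^ (-lamS) * μ t ^ lamS = 1 := by
      rw [← Real.rpow_add (hμ t), neg_add_cancel, Real.rpow_zero]
    have hb3 : μ t ^ (-lamS)
          * (∫ r in τ..t, D * δ * ‖u r - v r‖ * (μ t ^ lamS * (μ r ^ (-lamS - 1) * deriv μ r)))
        = ∫ r in τ..t, D * δ * ((μ r)⁻¹ * deriv μ r) * (μ r ^ (-lamS) * ‖u r - v r‖) := by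
      rw [← intervalIntegral.integral_const_mul]
      refine intervalIntegral.integral_congr fun r _ => ?_
      rw [Real.rpow_sub_one (hμ r).ne']
      linear_combination (D * δ * ‖u r - v r‖ * (μ r ^ (-lamS) / μ r * deriv μ r)) * h1
    rw [← hb3]
    have h0 : 0 ≤ μ t ^ (-lamS) := Real.rpow_nonneg (hμ t).le _
    have hC' : μ t ^ (-lamS) * (D * (μ t / μ τ) ^ lamS * μ τ ^ (Real.sign τ * ν) * ‖u τ - v τ‖)
        = C := by
      rw [hC, Real.div_rpow (hμ t).le (hμ τ).le lamS, Real.rpow_neg (hμ τ).le, div_eq_mul_inv]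
      linear_combination (D * (μ τ ^ lamS)⁻¹ * μ τ ^ (Real.sign τ * ν) * ‖u τ - v τ‖) * h1
    rw [← hC', ← mul_add]
    refine mul_le_mul_of_nonneg_left ?_ h0
    rw [heq]
    exact norm_add_le_of_le hb1 hb2

theorem stableField_reverse (A π : ℝ → Phase n →L[ℝ] Phase n) (f : ℝ → Phase n → Phase n) :
    stableField (fun t => -A (-t)) (fun t => coProj π (-t)) (reverseField f)
      = reverseField (unstableField A π f) := by
  funext t x
  simp [stableField, reverseField, unstableField, add_comm]

theorem fullField_reverse (A : ℝ → Phase n →L[ℝ] Phase n) (f : ℝ → Phase n → Phase n) :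
    fullField (fun t => -A (-t)) (reverseField f) = reverseField (fullField A f) := by
  funext t x
  simp [fullField, reverseField, add_comm]

theorem unstable_rate_pos (h : PerturbedDichotomy μ A Ψ π f D lamS lamU ν ω θ δ) :
    0 < lamU - D * δ := by
  linarith [h.reverse.stable_rate_neg]

theorem expandsAtRate (h : PerturbedDichotomy μ A Ψ π f D lamS lamU ν ω θ δ) :
    ExpandsAtRate μ (unstableField A π f) (unstableSubspace π) D (lamU - D * δ) ω := by
  intro u v hu hv huX hvX t τ htτ
  have hc := h.reverse.contractsAtRate
  rw [stableField_reverse] at hc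
  have := hc _ _ hu.reverse hv.reverse (fun t => huX (-t)) (fun t => hvX (-t)) (-t) (-τ)
    (neg_le_neg htτ)
  have hμ := h.growth.pos
  have hq : ((μ t)⁻¹ / (μ τ)⁻¹) ^ (-lamU + D * δ) = (μ t / μ τ) ^ (lamU - D * δ) := by
    rw [← inv_div_inv, inv_inv, inv_inv, ← inv_div, Real.inv_rpow (div_pos (hμ _) (hμ _)).le,
      ← Real.rpow_neg (div_pos (hμ _) (hμ _)).le]
    ring_nf
  have hs : ((μ τ)⁻¹) ^ (Real.sign (-τ) * ω) = μ τ ^ (Real.sign τ * ω) := by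
    rw [Real.inv_rpow (hμ _).le, ← Real.rpow_neg (hμ _).le, Real.sign_neg, neg_mul, neg_neg]
  simpa only [neg_neg, hq, hs] using this

end PerturbedDichotomy

/-! ### Tails of power integrals and the resulting Lyapunov–Perron estimates -/

namespace IsDifferentiableGrowthRate

variable {μ : ℝ → ℝ}

theorem tendsto_rpow_atTop (hμ : IsDifferentiableGrowthRate μ) {c : ℝ} (hc : c < 0) :
    Tendsto (fun t => μ t ^ c) atTop (𝓝 0) := by
  simpa [Function.comp_def] using (tendsto_rpow_neg_atTop (neg_pos.mpr hc)).comp hμ.tendsto_atTop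

theorem integrableOn_Ioi_rpow (hμ : IsDifferentiableGrowthRate μ) {c : ℝ} (hc : c < 0) (t : ℝ) :
    IntegrableOn (fun r => μ r ^ (c - 1) * deriv μ r) (Set.Ioi t) :=
  integrableOn_Ioi_deriv_of_nonneg' (fun r _ => hμ.hasDerivAt_rpow hc.ne r)
    (fun r _ => hμ.rpow_mul_deriv_nonneg _ r) ((hμ.tendsto_rpow_atTop hc).div_const c)

theorem integral_Ioi_rpow (hμ : IsDifferentiableGrowthRate μ) {c : ℝ} (hc : c < 0) (t : ℝ) :
    ∫ r in Set.Ioi t, μ r ^ (c - 1) * deriv μ r = μ t ^ c / (-c) := by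
  rw [integral_Ioi_of_hasDerivAt_of_nonneg' (fun r _ => hμ.hasDerivAt_rpow hc.ne r)
    (fun r _ => hμ.rpow_mul_deriv_nonneg _ r) ((hμ.tendsto_rpow_atTop hc).div_const c), zero_div,
    zero_sub, div_neg]

end IsDifferentiableGrowthRate

namespace PerturbedDichotomy

variable {n : ℕ} {μ : ℝ → ℝ} {A : ℝ → Phase n →L[ℝ] Phase n}
  {Ψ : ℝ → ℝ → Phase n →L[ℝ] Phase n} {π : ℝ → Phase n →L[ℝ] Phase n}
  {f : ℝ → Phase n → Phase n} {D lamS lamU ν ω θ δ : ℝ}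

theorem D_pos (h : PerturbedDichotomy μ A Ψ π f D lamS lamU ν ω θ δ) : 0 < D :=
  zero_lt_one.trans_le h.dichotomy.one_le

/-- The kernel bound integrates to at most `D * δ * m / (-lamS)`, whatever the length of the
interval. -/
theorem norm_integral_proj_le (h : PerturbedDichotomy μ A Ψ π f D lamS lamU ν ω θ δ)
    {g : ℝ → Phase n} {s t m : ℝ} (hst : s ≤ t)
    (hb : ∀ r, s ≤ r → ‖g r‖ ≤ lipWeight μ θ δ r * m) (hm : 0 ≤ m) :
    ‖∫ r in s..t, Ψ t r (π r (g r))‖ ≤ m / 8 := by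
  have hμ := h.growth.pos
  have hp := h.growth.isPrimitive_rpow (neg_ne_zero.mpr h.dichotomy.lamS_neg.ne)
  have h1 : ‖∫ r in s..t, Ψ t r (π r (g r))‖
      ≤ ∫ r in s..t, D * δ * m * (μ t ^ lamS * (μ r ^ (-lamS - 1) * deriv μ r)) :=
    intervalIntegral.norm_integral_le_of_norm_le hst
      (Eventually.of_forall fun r hr => h.norm_evolution_proj_le hr.2 (hb r hr.1.le) hm)
      (((hp.integrable s t).const_mul _).const_mul _)
  rw [intervalIntegral.integral_const_mul, intervalIntegral.integral_const_mul,
    hp.integral_eq_sub] at h1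
  have h2 : μ t ^ lamS * (μ t ^ (-lamS) / -lamS - μ s ^ (-lamS) / -lamS) ≤ 1 / -lamS := by
    have e : μ t ^ lamS * μ t ^ (-lamS) = 1 := by
      rw [← Real.rpow_add (hμ t), add_neg_cancel, Real.rpow_zero]
    have hl : 0 < -lamS := neg_pos.mpr h.dichotomy.lamS_neg
    rw [← sub_div, ← mul_div_assoc, mul_sub, e]
    refine div_le_div_of_nonneg_right ?_ hl.le
    linarith [mul_nonneg (Real.rpow_nonneg (hμ t).le lamS) (Real.rpow_nonneg (hμ s).le (-lamS))]
  have h3 := mul_le_mul_of_nonneg_left h2 (mul_nonneg h.D_delta_pos.le hm)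
  have h4 : D * δ * (1 / -lamS) ≤ 1 / 8 := by
    rw [mul_one_div, div_le_iff₀ (neg_pos.mpr h.dichotomy.lamS_neg)]
    linarith [h.D_delta_le, h.small_stable]
  nlinarith

/-- The left side equals `D * δ * m / lamU`. The spare `D ^ 2` from the smallness condition is kept
because it makes the slope of the leaves small relative to the norms of the projections. -/
theorem norm_evolution_coProj_tail_le (h : PerturbedDichotomy μ A Ψ π f D lamS lamU ν ω θ δ)
    {t m : ℝ} (hm : 0 ≤ m) :
    D * δ * m * (μ t ^ lamU * ∫ r in Set.Ioi t, μ r ^ (-lamU - 1) * deriv μ r)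
      ≤ m / (8 * D ^ 2) := by
  have hμ := h.growth.pos
  have hl := h.dichotomy.lamU_pos
  have e : μ t ^ lamU * μ t ^ (-lamU) = 1 := by
    rw [← Real.rpow_add (hμ t), add_neg_cancel, Real.rpow_zero]
  rw [h.growth.integral_Ioi_rpow (neg_neg_of_pos hl), neg_neg, ← mul_div_assoc, e, mul_one_div,
    div_le_div_iff₀ hl (by have := h.D_pos; positivity)]
  nlinarith [mul_le_mul_of_nonneg_left h.small_unstable.le hm]

theorem integrableOn_evolution_coProj (h : PerturbedDichotomy μ A Ψ π f D lamS lamU ν ω θ δ)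
    {g : ℝ → Phase n} (hg : ∀ a b, IntervalIntegrable g volume a b) {t m : ℝ}
    (hb : ∀ r, t ≤ r → ‖g r‖ ≤ lipWeight μ θ δ r * m) (hm : 0 ≤ m) :
    IntegrableOn (fun r => Ψ t r (coProj π r (g r))) (Set.Ioi t) := by
  have hmeas : AEStronglyMeasurable (fun r => Ψ t r (coProj π r (g r))) volume :=
    (locallyIntegrable_of_intervalIntegrable
      (isPrimitive_integral hg 0 0 |>.intervalIntegrable_apply
        ((h.evolution.continuous_right h.locallyIntegrable t).clm_comp
          h.continuous_coProj))).aestronglyMeasurable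
  refine Integrable.mono' (((h.growth.integrableOn_Ioi_rpow
    (neg_neg_of_pos h.dichotomy.lamU_pos) t).const_mul (μ t ^ lamU)).const_mul (D * δ * m))
    hmeas.restrict ?_
  filter_upwards [ae_restrict_mem measurableSet_Ioi] with r hr
  exact h.norm_evolution_coProj_le (le_of_lt hr) (hb r (le_of_lt hr)) hm

theorem norm_integral_Ioi_coProj_le (h : PerturbedDichotomy μ A Ψ π f D lamS lamU ν ω θ δ)
    {g : ℝ → Phase n} {t m : ℝ} (hb : ∀ r, t ≤ r → ‖g r‖ ≤ lipWeight μ θ δ r * m)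
    (hm : 0 ≤ m) :
    ‖∫ r in Set.Ioi t, Ψ t r (coProj π r (g r))‖ ≤ m / (8 * D ^ 2) := by
  refine le_trans (norm_integral_le_of_norm_le (((h.growth.integrableOn_Ioi_rpow
    (neg_neg_of_pos h.dichotomy.lamU_pos) t).const_mul (μ t ^ lamU)).const_mul (D * δ * m)) ?_) ?_
  · filter_upwards [ae_restrict_mem measurableSet_Ioi] with r hr
    exact h.norm_evolution_coProj_le (le_of_lt hr) (hb r (le_of_lt hr)) hm
  · rw [integral_const_mul, integral_const_mul]
    exact h.norm_evolution_coProj_tail_le hm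

theorem div_D_sq_le (h : PerturbedDichotomy μ A Ψ π f D lamS lamU ν ω θ δ) {m : ℝ}
    (hm : 0 ≤ m) : m / (8 * D ^ 2) ≤ m / 8 :=
  div_le_div_of_nonneg_left hm (by norm_num) (by nlinarith [h.dichotomy.one_le])

theorem norm_evolution_proj_zero_le (h : PerturbedDichotomy μ A Ψ π f D lamS lamU ν ω θ δ)
    {t : ℝ} (ht : 0 ≤ t) (x : Phase n) : ‖Ψ t 0 (π 0 x)‖ ≤ D * ‖π 0 x‖ := by
  have hx : Ψ t 0 (π 0 x) = ((Ψ t 0).comp (π 0)) (π 0 x) := by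
    rw [ContinuousLinearMap.comp_apply, h.proj_apply_self]
  rw [hx]
  refine ((Ψ t 0).comp (π 0)).le_of_opNorm_le ((h.dichotomy.stable_bound t 0 ht).trans ?_) _
  rw [h.growth.map_zero, div_one, Real.one_rpow, mul_one]
  exact mul_le_of_le_one_right h.D_pos.le
    (Real.rpow_le_one_of_one_le_of_nonpos (h.growth.one_le ht) h.dichotomy.lamS_neg.le)

/-! ### A priori bounds for solutions at bounded distance -/

section Bounded

variable {u v : ℝ → Phase n}

theorem isPrimitive_sub (h : PerturbedDichotomy μ A Ψ π f D lamS lamU ν ω θ δ)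
    (hu : IsSolution (fullField A f) u) (hv : IsSolution (fullField A f) v) :
    IsPrimitive (fun r => Ψ 0 r (f r (u r) - f r (v r))) (fun r => Ψ 0 r (u r - v r)) := by
  simpa only [← map_sub] using
    ((h.evolution.isSolution_add_iff h.locallyIntegrable).mp hu).sub
      ((h.evolution.isSolution_add_iff h.locallyIntegrable).mp hv)

theorem lipWeight_mul_le (h : PerturbedDichotomy μ A Ψ π f D lamS lamU ν ω θ δ) {m : ℝ} {r : ℝ}
    {x y : Phase n} (hxy : ‖x - y‖ ≤ m) : ‖f r x - f r y‖ ≤ lipWeight μ θ δ r * m :=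
  (h.perturbation.lipschitz r x y).trans
    (mul_le_mul_of_nonneg_left hxy (h.growth.lipWeight_nonneg h.delta_pos.le θ r))

theorem intervalIntegrable_perturbation (h : PerturbedDichotomy μ A Ψ π f D lamS lamU ν ω θ δ)
    (hu : Continuous u) (hv : Continuous v) (a b : ℝ) :
    IntervalIntegrable (fun r => f r (u r) - f r (v r)) volume a b :=
  (h.caratheodoryLipschitz_perturbation.intervalIntegrable hu a b).sub
    (h.caratheodoryLipschitz_perturbation.intervalIntegrable hv a b)

/-- The unstable component of a bounded difference of solutions is controlled by the nonlinearity
alone. -/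
theorem norm_coProj_sub_le (h : PerturbedDichotomy μ A Ψ π f D lamS lamU ν ω θ δ)
    (hu : IsSolution (fullField A f) u) (hv : IsSolution (fullField A f) v) {m : ℝ}
    (hm : ∀ t, 0 ≤ t → ‖u t - v t‖ ≤ m) {t : ℝ} (ht : 0 ≤ t) :
    ‖coProj π t (u t - v t)‖ ≤ m / (8 * D ^ 2) := by
  have hμ := h.growth.pos
  have hm0 : 0 ≤ m := (norm_nonneg _).trans (hm t ht)
  have hp := h.isPrimitive_evolution_coProj (h.isPrimitive_sub hu hv) t
  have hb : ∀ r, t ≤ r → ‖f r (u r) - f r (v r)‖ ≤ lipWeight μ θ δ r * m := fun r hr =>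
    h.lipWeight_mul_le (hm r (ht.trans hr))
  have hint := h.integrableOn_evolution_coProj
    (h.intervalIntegrable_perturbation hu.continuous hv.continuous) hb hm0
  have hlim1 := intervalIntegral_tendsto_integral_Ioi t hint tendsto_id
  -- The boundary term at infinity is at most a constant times `μ s ^ (ω - lamU)`; boundedness of
  -- the difference and the unstable gap make it vanish.
  have hlim2 : Tendsto (fun s => Ψ t s (coProj π s (u s - v s))) atTop (𝓝 0) := by
    have hg : ω - lamU < 0 := by linarith [h.dichotomy.unstable_gap]
    have hz := (h.growth.tendsto_rpow_atTop hg).const_mul (D * μ t ^ lamU * m)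
    rw [mul_zero] at hz
    refine squeeze_zero_norm' ?_ hz
    filter_upwards [eventually_ge_atTop t, eventually_gt_atTop 0] with s hs hs0
    have := (((Ψ t s).comp (coProj π s)).le_of_opNorm_le (h.dichotomy.unstable_bound t s hs)
      (u s - v s))
    refine this.trans ?_
    rw [Real.sign_of_pos hs0, one_mul, Real.rpow_sub (hμ s), Real.div_rpow (hμ t).le (hμ s).le]
    have hpos : 0 ≤ D * (μ t ^ lamU / μ s ^ lamU) * μ s ^ ω :=
      mul_nonneg (mul_nonneg h.D_pos.le (div_nonneg (Real.rpow_nonneg (hμ t).le _)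
        (Real.rpow_nonneg (hμ s).le _))) (Real.rpow_nonneg (hμ s).le _)
    refine (mul_le_mul_of_nonneg_left (hm s hs0.le) hpos).trans (le_of_eq ?_)
    ring
  have hlim3 := hlim2.sub hlim1
  have heq : ∀ s, Ψ t s (coProj π s (u s - v s))
      - ∫ r in t..s, Ψ t r (coProj π r (f r (u r) - f r (v r))) = coProj π t (u t - v t) :=
    fun s => by
      rw [hp.integral_eq_sub, h.evolution.self]
      simp
  have := tendsto_nhds_unique (tendsto_const_nhds.congr fun s => (heq s).symm) hlim3
  rw [this, zero_sub, norm_neg]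
  exact h.norm_integral_Ioi_coProj_le hb hm0

/-- A bound `m` improves to `D * ‖π 0 (u 0 - v 0)‖ + m / 4`. Applied to the supremum, which is
finite by hypothesis, this gives the constant `4 * D / 3`, rounded up to `2 * D`. Since the bound
depends only on the initial values, it also yields closedness of the leaf relation. -/
theorem norm_sub_le_of_bounded (h : PerturbedDichotomy μ A Ψ π f D lamS lamU ν ω θ δ)
    (hu : IsSolution (fullField A f) u) (hv : IsSolution (fullField A f) v)
    (hM : ∃ M : ℝ, ∀ t, 0 ≤ t → ‖u t - v t‖ ≤ M) {t : ℝ} (ht : 0 ≤ t) :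
    ‖u t - v t‖ ≤ 2 * D * ‖π 0 (u 0 - v 0)‖ := by
  obtain ⟨M, hM⟩ := hM
  have step : ∀ m, (∀ t, 0 ≤ t → ‖u t - v t‖ ≤ m) →
      ∀ t, 0 ≤ t → ‖u t - v t‖ ≤ D * ‖π 0 (u 0 - v 0)‖ + m / 4 := by
    intro m hm t ht
    have hm0 : 0 ≤ m := (norm_nonneg _).trans (hm t ht)
    have hp := (h.isPrimitive_evolution_proj (h.isPrimitive_sub hu hv) t).eq_integral 0 t
    rw [h.evolution.self, ContinuousLinearMap.id_apply] at hp
    have h1 : ‖π t (u t - v t)‖ ≤ D * ‖π 0 (u 0 - v 0)‖ + m / 8 := by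
      rw [hp]
      exact norm_add_le_of_le (h.norm_evolution_proj_zero_le ht _)
        (h.norm_integral_proj_le ht (fun r hr => h.lipWeight_mul_le (hm r hr)) hm0)
    have h2 := (h.norm_coProj_sub_le hu hv hm ht).trans (h.div_D_sq_le hm0)
    calc ‖u t - v t‖ = ‖π t (u t - v t) + coProj π t (u t - v t)‖ := by rw [proj_add_coProj]
      _ ≤ _ := norm_add_le_of_le h1 h2
      _ = _ := by ring
  set s : Set ℝ := (fun t => ‖u t - v t‖) '' Set.Ici 0
  have hbdd : BddAbove s := ⟨M, by rintro _ ⟨t, ht, rfl⟩; exact hM t ht⟩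
  have hle : ∀ t, 0 ≤ t → ‖u t - v t‖ ≤ sSup s := fun t ht => le_csSup hbdd ⟨t, ht, rfl⟩
  have hsup : sSup s ≤ D * ‖π 0 (u 0 - v 0)‖ + sSup s / 4 :=
    csSup_le ⟨_, 0, Set.self_mem_Ici, rfl⟩ (by rintro _ ⟨t, ht, rfl⟩; exact step _ hle t ht)
  have hD : 0 ≤ D * ‖π 0 (u 0 - v 0)‖ := mul_nonneg h.D_pos.le (norm_nonneg _)
  linarith [hle t ht]

/-- The slope bound for leaves: the a priori constant `2 * D` divided by `8 * D ^ 2`. -/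
theorem norm_coProj_zero_sub_le (h : PerturbedDichotomy μ A Ψ π f D lamS lamU ν ω θ δ)
    (hu : IsSolution (fullField A f) u) (hv : IsSolution (fullField A f) v)
    (hM : ∃ M : ℝ, ∀ t, 0 ≤ t → ‖u t - v t‖ ≤ M) :
    ‖coProj π 0 (u 0 - v 0)‖ ≤ 1 / (4 * D) * ‖π 0 (u 0 - v 0)‖ := by
  refine (h.norm_coProj_sub_le hu hv (fun t ht => h.norm_sub_le_of_bounded hu hv hM ht)
    le_rfl).trans (le_of_eq ?_)
  have := h.D_pos.ne'
  field_simp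
  ring

end Bounded

/-! ### The Lyapunov–Perron operator and existence of leaves -/

section LyapunovPerron

/-- The Lyapunov–Perron operator: it produces the solution of `w' = A w + g` bounded on `[0, ∞)`
whose stable component vanishes at time `0`. -/
noncomputable def lyapunovPerron (Ψ : ℝ → ℝ → Phase n →L[ℝ] Phase n)
    (π : ℝ → Phase n →L[ℝ] Phase n) (g : ℝ → Phase n) (t : ℝ) : Phase n :=
  Ψ t 0 ((∫ r in (0 : ℝ)..t, Ψ 0 r (g r)) - ∫ r in Set.Ioi (0 : ℝ), Ψ 0 r (coProj π r (g r)))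

variable {g g' : ℝ → Phase n} {m m' : ℝ}

theorem intervalIntegrable_evolution (h : PerturbedDichotomy μ A Ψ π f D lamS lamU ν ω θ δ)
    (hg : ∀ a b, IntervalIntegrable g volume a b) (t a b : ℝ) :
    IntervalIntegrable (fun r => Ψ t r (g r)) volume a b :=
  (isPrimitive_integral hg 0 0).intervalIntegrable_apply
    (h.evolution.continuous_right h.locallyIntegrable t) a b

theorem continuous_lyapunovPerron (h : PerturbedDichotomy μ A Ψ π f D lamS lamU ν ω θ δ)
    (hg : ∀ a b, IntervalIntegrable g volume a b) : Continuous (lyapunovPerron Ψ π g) :=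
  (h.evolution.continuous 0).clm_apply ((intervalIntegral.continuous_primitive
    (h.intervalIntegrable_evolution hg 0) 0).sub continuous_const)

theorem lyapunovPerron_sub (h : PerturbedDichotomy μ A Ψ π f D lamS lamU ν ω θ δ)
    (hg : ∀ a b, IntervalIntegrable g volume a b) (hg' : ∀ a b, IntervalIntegrable g' volume a b)
    (hb : ∀ r, 0 ≤ r → ‖g r‖ ≤ lipWeight μ θ δ r * m)
    (hb' : ∀ r, 0 ≤ r → ‖g' r‖ ≤ lipWeight μ θ δ r * m') (hm : 0 ≤ m) (hm' : 0 ≤ m') (t : ℝ) :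
    lyapunovPerron Ψ π g t - lyapunovPerron Ψ π g' t
      = lyapunovPerron Ψ π (fun r => g r - g' r) t := by
  simp only [lyapunovPerron, ← map_sub]
  simp only [map_sub]
  rw [intervalIntegral.integral_sub (h.intervalIntegrable_evolution hg 0 0 t)
    (h.intervalIntegrable_evolution hg' 0 0 t), integral_sub
    (h.integrableOn_evolution_coProj hg hb hm) (h.integrableOn_evolution_coProj hg' hb' hm')]
  simp only [map_sub]
  abel

/-- The definition pulls everything back to time `0`, which makes continuity immediate but hides the
decay. Splitting the tail at `t` cancels the unstable part of the past and leaves the stable past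
minus the unstable future, each at most `m / 8`. -/
theorem norm_lyapunovPerron_le (h : PerturbedDichotomy μ A Ψ π f D lamS lamU ν ω θ δ)
    (hg : ∀ a b, IntervalIntegrable g volume a b)
    (hb : ∀ r, 0 ≤ r → ‖g r‖ ≤ lipWeight μ θ δ r * m) (hm : 0 ≤ m) {t : ℝ} (ht : 0 ≤ t) :
    ‖lyapunovPerron Ψ π g t‖ ≤ m / 4 := by
  have hc := h.integrableOn_evolution_coProj hg hb hm
  have hmul : ∀ r x, Ψ t 0 (Ψ 0 r x) = Ψ t r x := fun r x =>
    h.evolution.apply_apply h.locallyIntegrable t 0 r x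
  have hsplit : ∀ r, Ψ t r (g r) = Ψ t r (π r (g r)) + Ψ t r (coProj π r (g r)) := fun r => by
    rw [← map_add, proj_add_coProj]
  have hcg : ∀ a b, IntervalIntegrable (fun r => coProj π r (g r)) volume a b :=
    (isPrimitive_integral hg 0 0).intervalIntegrable_apply h.continuous_coProj
  have hpg : ∀ a b, IntervalIntegrable (fun r => π r (g r)) volume a b :=
    (isPrimitive_integral hg 0 0).intervalIntegrable_apply h.continuous_proj
  have htail : Ψ t 0 (∫ r in Set.Ioi (0 : ℝ), Ψ 0 r (coProj π r (g r)))
      = (∫ r in (0 : ℝ)..t, Ψ t r (coProj π r (g r)))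
        + ∫ r in Set.Ioi t, Ψ t r (coProj π r (g r)) := by
    have hc0 := (Ψ t 0).integrable_comp hc
    simp only [hmul] at hc0
    rw [← ContinuousLinearMap.integral_comp_comm _ hc]
    simp only [hmul]
    rw [intervalIntegral.integral_of_le ht, ← setIntegral_union (Set.Ioc_disjoint_Ioi le_rfl)
      measurableSet_Ioi, Set.Ioc_union_Ioi_eq_Ioi ht]
    · exact hc0.mono_measure (Measure.restrict_mono_set _ Set.Ioc_subset_Ioi_self)
    · exact hc0.mono_measure (Measure.restrict_mono_set _ (Set.Ioi_subset_Ioi ht))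
  have heq : lyapunovPerron Ψ π g t = (∫ r in (0 : ℝ)..t, Ψ t r (π r (g r)))
      - ∫ r in Set.Ioi t, Ψ t r (coProj π r (g r)) := by
    rw [lyapunovPerron, map_sub, htail, ← ContinuousLinearMap.intervalIntegral_comp_comm _
      (h.intervalIntegrable_evolution hg 0 0 t)]
    simp only [hmul, hsplit]
    rw [intervalIntegral.integral_add (h.intervalIntegrable_evolution hpg t 0 t)
      (h.intervalIntegrable_evolution hcg t 0 t)]
    abel
  have hb' : ∀ r, t ≤ r → ‖g r‖ ≤ lipWeight μ θ δ r * m := fun r hr => hb r (ht.trans hr)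
  rw [heq]
  refine (norm_sub_le_of_le (h.norm_integral_proj_le ht hb hm)
    ((h.norm_integral_Ioi_coProj_le hb' hm).trans (h.div_D_sq_le hm))).trans (le_of_eq ?_)
  ring

theorem proj_lyapunovPerron_zero (h : PerturbedDichotomy μ A Ψ π f D lamS lamU ν ω θ δ)
    (hg : ∀ a b, IntervalIntegrable g volume a b)
    (hb : ∀ r, 0 ≤ r → ‖g r‖ ≤ lipWeight μ θ δ r * m) (hm : 0 ≤ m) :
    π 0 (lyapunovPerron Ψ π g 0) = 0 := by
  rw [lyapunovPerron, h.evolution.self, ContinuousLinearMap.id_apply,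
    intervalIntegral.integral_same, zero_sub, map_neg,
    ← ContinuousLinearMap.integral_comp_comm _ (h.integrableOn_evolution_coProj hg hb hm)]
  simp [h.proj_evolution, h.proj_coProj]

end LyapunovPerron

/-- Every stable leaf at time `0` meets every translate of the unstable subspace. -/
theorem exists_mem_stableLeaf (h : PerturbedDichotomy μ A Ψ π f D lamS lamU ν ω θ δ)
    (x a : Phase n) : ∃ y ∈ stableLeaf (fullField A f) 0 x, π 0 y = π 0 a := by
  obtain ⟨k, hk⟩ := h.exists_caratheodoryLipschitz_full
  obtain ⟨u, hu, hu0⟩ := hk.exists_solution 0 x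
  set ξ := π 0 (a - x) with hξ
  let G : BoundedContinuousFunction ℝ (Phase n) → ℝ → Phase n :=
    fun w r => f r (u r + w r) - f r (u r)
  have hGi : ∀ w a b, IntervalIntegrable (G w) volume a b := fun w =>
    h.intervalIntegrable_perturbation (hu.continuous.add w.continuous) hu.continuous
  have hGd : ∀ (w w' : BoundedContinuousFunction ℝ (Phase n)) (r : ℝ),
      ‖G w r - G w' r‖ ≤ lipWeight μ θ δ r * ‖w - w'‖ := fun w w' r => by
    simp only [G, sub_sub_sub_cancel_right]
    refine h.lipWeight_mul_le ?_
    rw [add_sub_add_left_eq_sub]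
    exact (w - w').norm_coe_le_norm r
  have hGb : ∀ (w : BoundedContinuousFunction ℝ (Phase n)) (r : ℝ), 0 ≤ r →
      ‖G w r‖ ≤ lipWeight μ θ δ r * ‖w‖ := fun w r _ => by
    refine h.lipWeight_mul_le ?_
    rw [add_sub_cancel_left]
    exact w.norm_coe_le_norm r
  -- The estimates hold only for `t ≥ 0`; freezing time at `max t 0` lets the fixed point live among
  -- bounded continuous functions on all of `ℝ`.
  have hmax : Continuous fun t : ℝ => max t 0 := continuous_id.max continuous_const
  let T : BoundedContinuousFunction ℝ (Phase n) → BoundedContinuousFunction ℝ (Phase n) :=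
    fun w => BoundedContinuousFunction.ofNormedAddCommGroup
      (fun t => Ψ (max t 0) 0 ξ + lyapunovPerron Ψ π (G w) (max t 0))
      ((((h.evolution.continuous 0).clm_apply continuous_const).add
        (h.continuous_lyapunovPerron (hGi w))).comp hmax)
      (D * ‖ξ‖ + ‖w‖ / 4) fun t => norm_add_le_of_le
        (h.norm_evolution_proj_zero_le (le_max_right _ _) _)
        (h.norm_lyapunovPerron_le (hGi w) (hGb w) (norm_nonneg _) (le_max_right _ _))
  obtain ⟨w, hw⟩ := exists_fixedPoint_of_norm_sub_le (T := T) (q := 1 / 4) (by norm_num)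
    fun w w' => by
      refine (BoundedContinuousFunction.norm_le (by positivity)).mpr fun t => ?_
      change ‖Ψ (max t 0) 0 ξ + lyapunovPerron Ψ π (G w) (max t 0)
        - (Ψ (max t 0) 0 ξ + lyapunovPerron Ψ π (G w') (max t 0))‖ ≤ _
      rw [add_sub_add_left_eq_sub, h.lyapunovPerron_sub (hGi w) (hGi w') (hGb w) (hGb w')
        (norm_nonneg _) (norm_nonneg _)]
      refine (h.norm_lyapunovPerron_le (fun a b => (hGi w a b).sub (hGi w' a b))
        (fun r _ => hGd w w' r) (norm_nonneg _) (le_max_right _ _)).trans (le_of_eq (by ring))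
  have hfix : ∀ t, 0 ≤ t → w t = Ψ t 0 ξ + lyapunovPerron Ψ π (G w) t := fun t ht => by
    have : w t = Ψ (max t 0) 0 ξ + lyapunovPerron Ψ π (G w) (max t 0) := by
      conv_lhs => rw [← hw]
      rfl
    rwa [max_eq_left ht] at this
  -- The fixed point `w` is meaningful only on `[0, ∞)`, while leaves are defined by global
  -- solutions. So a global solution `v` is taken with the right initial value and shown to equal `u
  -- + w` for `t ≥ 0`.
  obtain ⟨v, hv, hv0⟩ := hk.exists_solution 0 (x + w 0)
  have hwp : ∀ t, 0 ≤ t → Ψ 0 t (w t) = w 0 + ∫ r in (0 : ℝ)..t, Ψ 0 r (G w r) := fun t ht => by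
    rw [hfix t ht, hfix 0 le_rfl]
    simp only [lyapunovPerron, map_add, h.evolution.apply_apply_self h.locallyIntegrable,
      h.evolution.self, intervalIntegral.integral_same, ContinuousLinearMap.id_apply]
    abel
  have hker := h.caratheodoryLipschitz_perturbation.comp_clm
    (h.evolution.continuous_right h.locallyIntegrable 0) (h.evolution.continuous 0)
  have hcont : Continuous fun t => v t - (u t + w t) :=
    hv.continuous.sub (hu.continuous.add w.continuous)
  have hΨc := h.evolution.continuous_right h.locallyIntegrable 0
  -- Pulled back by `Ψ 0 t`, the difference obeys an integral inequality without linear term and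
  -- with initial value `0`.
  have hgr := gronwall_of_le_integral (g := fun t => ‖Ψ 0 t (v t - (u t + w t))‖) (C := 0)
    (s := 0) (isPrimitive_integral hker.integrable 0 0) hker.nonneg
    (hΨc.clm_apply hcont).norm fun t ht => by
      have h1 := (h.isPrimitive_sub hv hu).eq_integral 0 t
      have h2 : Ψ 0 t (v t - (u t + w t))
          = ∫ r in (0 : ℝ)..t, Ψ 0 r (f r (v r) - f r (u r + w r)) := by
        have e : v t - (u t + w t) = (v t - u t) - w t := by abel
        rw [e, map_sub, h1, hwp t ht, hv0, hu0, h.evolution.self, add_sub_cancel_left,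
          ContinuousLinearMap.id_apply, add_sub_add_left_eq_sub, ← intervalIntegral.integral_sub
          ((h.isPrimitive_sub hv hu).integrable 0 t)
          (h.intervalIntegrable_evolution (hGi w) 0 0 t)]
        refine intervalIntegral.integral_congr fun r _ => ?_
        simp only [G, ← map_sub]
        congr 1
        abel
      rw [h2, zero_add]
      refine intervalIntegral.norm_integral_le_of_norm_le ht (Eventually.of_forall fun r _ => ?_)
        ((hker.integrable 0 t).mul_continuousOn (hΨc.clm_apply hcont).norm.continuousOn)
      have h3 := hker.lipschitz r (Ψ 0 r (v r)) (Ψ 0 r (u r + w r))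
      simpa only [h.evolution.apply_apply_self h.locallyIntegrable, ← map_sub] using h3
  have hvw : ∀ t, 0 ≤ t → v t - u t = w t := fun t ht => by
    have h1 := hgr t ht
    rw [zero_mul] at h1
    have h2 := congrArg (Ψ t 0) (norm_le_zero_iff.mp h1)
    rw [h.evolution.apply_apply_self h.locallyIntegrable, map_zero] at h2
    rw [sub_eq_iff_eq_add', sub_eq_zero.mp h2]
  refine ⟨x + w 0, ⟨u, v, hu, hv, hu0, hv0, ‖w‖, fun t ht => ?_⟩, ?_⟩
  · rw [norm_sub_rev, hvw t ht]
    exact w.norm_coe_le_norm t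
  · rw [map_add, hfix 0 le_rfl, map_add, h.proj_lyapunovPerron_zero (hGi w) (hGb w)
      (norm_nonneg _), h.evolution.self, ContinuousLinearMap.id_apply, hξ, h.proj_apply_self]
    simp

end PerturbedDichotomy

/-! ### Straightening two transverse Lipschitz foliations -/

/-- Along a convergent sequence the values stay in a compact ball, and closedness of the graph
leaves only one possible cluster point. -/
theorem continuous_of_isClosed_graph_of_bounded {X E : Type*} [NormedAddCommGroup X]
    [NormedAddCommGroup E] [ProperSpace E] {g : X → E} (hc : IsClosed {p : X × E | p.2 = g p.1})
    (hb : ∀ C : ℝ, ∃ C' : ℝ, ∀ x, ‖x‖ ≤ C → ‖g x‖ ≤ C') : Continuous g := by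
  refine continuous_iff_seqContinuous.mpr fun x a hx => ?_
  refine tendsto_of_subseq_tendsto fun ns hns => ?_
  have hx' := hx.comp hns
  obtain ⟨C, hC⟩ := (Metric.isBounded_range_of_tendsto _ hx').exists_norm_le
  obtain ⟨C', hC'⟩ := hb C
  obtain ⟨b, -, ms, hms, hlim⟩ := tendsto_subseq_of_bounded
    (Metric.isBounded_closedBall (x := (0 : E)) (r := C')) (x := fun k => g (x (ns k)))
    fun k => mem_closedBall_zero_iff.mpr (hC' _ (hC _ ⟨k, rfl⟩))
  refine ⟨ms, ?_⟩
  have hmem := hc.mem_of_tendsto ((hx'.comp hms.tendsto_atTop).prodMk_nhds hlim)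
    (Eventually.of_forall fun k => rfl)
  rw [← show b = g a from hmem]
  exact hlim

section Foliations

variable {E : Type*} [NormedAddCommGroup E] [NormedSpace ℝ E]

/-- The equivalence relation `R` is a continuous foliation whose leaves are `κ`-Lipschitz graphs
over the range of the projection `P`, with complementary projection `Q`. -/
structure IsLipschitzFoliation (R : E → E → Prop) (P Q : E →L[ℝ] E) (κ : ℝ) : Prop where
  equivalence : Equivalence R
  isClosed : IsClosed {p : E × E | R p.1 p.2}
  exists_mem : ∀ x a, ∃ y, R x y ∧ P y = P a
  norm_le : ∀ x y, R x y → ‖Q (y - x)‖ ≤ κ * ‖P (y - x)‖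

namespace IsLipschitzFoliation

variable {R R' : E → E → Prop} {P Q : E →L[ℝ] E} {κ : ℝ}

/-- A leaf is a graph over the range of `P`: zero displacement in the base forces zero displacement
in the fibre. -/
theorem eq_of_proj_eq (hR : IsLipschitzFoliation R P Q κ) (hPQ : ∀ x, P x + Q x = x) {x y : E}
    (hxy : R x y) (hP : P x = P y) : x = y := by
  have h1 := hR.norm_le x y hxy
  have h2 : P (y - x) = 0 := by rw [map_sub, hP, sub_self]
  rw [h2, norm_zero, mul_zero] at h1
  have h3 := hPQ (y - x)
  rw [h2, norm_le_zero_iff.mp h1, add_zero] at h3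
  exact (sub_eq_zero.mp h3.symm).symm

/-- The holonomy onto the transversal `ker P`. -/
theorem exists_holonomy [ProperSpace E] (hR : IsLipschitzFoliation R P Q κ)
    (hPQ : ∀ x, P x + Q x = x) :
    ∃ H : E → E, Continuous H ∧ (∀ x, R x (H x)) ∧ (∀ x, P (H x) = 0) ∧
      (∀ x, P x = 0 → H x = x) ∧ ∀ x y, R x y ↔ H y = H x := by
  choose H hH hH0 using fun x => hR.exists_mem x 0
  simp only [map_zero] at hH0
  have hs := fun {x y : E} => hR.equivalence.symm (x := x) (y := y)
  have ht := fun {x y z : E} => hR.equivalence.trans (x := x) (y := y) (z := z)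
  refine ⟨H, continuous_of_isClosed_graph_of_bounded ?_ fun C => ?_, hH, hH0, fun x hx =>
    (hR.eq_of_proj_eq hPQ (hH x) (by rw [hx, hH0])).symm, fun x y => ⟨fun h => ?_, fun h => ?_⟩⟩
  · have : {p : E × E | p.2 = H p.1} = {p : E × E | R p.1 p.2} ∩ {p : E × E | P p.2 = 0} := by
      ext ⟨x, y⟩
      refine ⟨fun h => ?_, fun h => ?_⟩
      · obtain rfl : y = H x := h
        exact ⟨hH x, hH0 x⟩
      · exact hR.eq_of_proj_eq hPQ (ht (hs h.1) (hH x)) (h.2.trans (hH0 x).symm)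
    rw [this]
    exact hR.isClosed.inter (isClosed_eq (P.continuous.comp continuous_snd) continuous_const)
  · refine ⟨‖Q‖ * C + |κ| * (‖P‖ * C), fun x hx => ?_⟩
    have h1 := hR.norm_le x (H x) (hH x)
    rw [map_sub P, hH0, zero_sub, norm_neg, map_sub] at h1
    have h2 : H x = Q x + (Q (H x) - Q x) := by
      have := hPQ (H x)
      rw [hH0, zero_add] at this
      rw [this]; abel
    rw [h2]
    refine norm_add_le_of_le (Q.le_opNorm_of_le hx) (h1.trans ?_)
    exact (mul_le_mul_of_nonneg_right (le_abs_self κ) (norm_nonneg _)).trans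
      (mul_le_mul_of_nonneg_left (P.le_opNorm_of_le hx) (abs_nonneg _))
  · exact hR.eq_of_proj_eq hPQ (ht (hs (hH y)) (ht (hs h) (hH x))) (by rw [hH0, hH0])
  · exact ht (hH x) (hs (h ▸ hH y))

/-- Two transverse foliations are simultaneously straightened by a homeomorphism. -/
theorem exists_homeomorph [ProperSpace E] (hR : IsLipschitzFoliation R P Q κ)
    (hR' : IsLipschitzFoliation R' Q P κ) (hPQ : ∀ x, P x + Q x = x) (hP : ∀ x, P (P x) = P x)
    (hκ : 0 ≤ κ) (hsmall : κ * (‖P‖ + ‖Q‖) < 1) :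
    ∃ S : E ≃ₜ E, S 0 = 0 ∧ (∀ x y, R x y ↔ Q (S y) = Q (S x)) ∧
      (∀ x y, R' x y ↔ P (S y) = P (S x)) ∧ (∀ x, R x (Q (S x))) ∧ (∀ x, R' x (P (S x))) ∧
      (∀ x, P x = 0 → Q (S x) = x) ∧ (∀ x, Q x = 0 → P (S x) = x) := by
  have hQP : ∀ x, Q x + P x = x := fun x => by rw [add_comm, hPQ]
  have hQ' : ∀ x, Q x = x - P x := fun x => eq_sub_of_add_eq' (hPQ x)
  obtain ⟨H, hHc, hH, hH0, hHid, hHiff⟩ := hR.exists_holonomy hPQ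
  obtain ⟨H', hHc', hH', hH0', hHid', hHiff'⟩ := hR'.exists_holonomy hQP
  have hQH : ∀ x, Q (H x) = H x := fun x => by rw [hQ', hH0, sub_zero]
  have hPH' : ∀ x, P (H' x) = H' x := fun x => by
    have := hPQ (H' x)
    rwa [hH0', add_zero] at this
  have hQS : ∀ x, Q (H x + H' x) = H x := fun x => by rw [map_add, hH0', hQH, add_zero]
  have hPS : ∀ x, P (H x + H' x) = H' x := fun x => by rw [map_add, hH0, hPH', zero_add]
  set q := κ * (‖P‖ + ‖Q‖) with hq
  have hcontr : ∀ d : E, κ * ‖P d‖ + κ * ‖Q d‖ ≤ q * ‖d‖ := fun d => by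
    rw [← mul_add, hq, mul_assoc, add_mul]
    exact mul_le_mul_of_nonneg_left (add_le_add (P.le_opNorm d) (Q.le_opNorm d)) hκ
  have hsplit : ∀ d : E, ‖d‖ ≤ ‖P d‖ + ‖Q d‖ := fun d => by
    conv_lhs => rw [← hPQ d]
    exact norm_add_le _ _
  have hinj : ∀ x y, R x y → R' x y → x = y := fun x y h h' => by
    have h1 := hR.norm_le x y h
    have h2 := hR'.norm_le x y h'
    have h3 := hsplit (y - x)
    have h4 := hcontr (y - x)
    have h5 : ‖y - x‖ ≤ 0 := by nlinarith [norm_nonneg (y - x)]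
    exact (sub_eq_zero.mp (norm_le_zero_iff.mp h5)).symm
  -- A preimage of `z` is a common point of the `R`-leaf of `Q z` and the `R'`-leaf of `P z`. Here
  -- `α p` is the point of the former over `P p` and `β p` the point of the latter over `Q p`; the
  -- common points are the fixed points of `p ↦ Q (α p) + P (β p)`, which contracts by the slope
  -- bounds.
  have hsurj : ∀ z, ∃ p, H p + H' p = z := fun z => by
    choose α hα hαP using fun p => hR.exists_mem (Q z) p
    choose β hβ hβQ using fun p => hR'.exists_mem (P z) p
    have hs := hR.equivalence
    have hs' := hR'.equivalence
    obtain ⟨p, hp⟩ := exists_fixedPoint_of_norm_sub_le (T := fun p => Q (α p) + P (β p)) hsmall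
      fun v w => by
        have h1 := hR.norm_le (α w) (α v) (hs.trans (hs.symm (hα w)) (hα v))
        have h2 := hR'.norm_le (β w) (β v) (hs'.trans (hs'.symm (hβ w)) (hβ v))
        rw [map_sub P, hαP, hαP, ← map_sub P] at h1
        rw [map_sub Q, hβQ, hβQ, ← map_sub Q] at h2
        rw [add_sub_add_comm, ← map_sub, ← map_sub]
        exact (norm_add_le_of_le h1 h2).trans (hcontr _)
    have hQQ : ∀ x, Q (Q x) = Q x := fun x => by simp [hQ', hP]
    have hPQ0 : ∀ x, P (Q x) = 0 := fun x => by simp [hQ', hP]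
    have hQP0 : ∀ x, Q (P x) = 0 := fun x => by simp [hQ', hP]
    have hα' : α p = p := by
      have h1 : Q p = Q (α p) := by
        conv_lhs => rw [← hp]
        simp only [map_add, hQQ, hQP0, add_zero]
      rw [← hPQ (α p), hαP, ← h1, hPQ]
    have hβ' : β p = p := by
      have h1 : P p = P (β p) := by
        conv_lhs => rw [← hp]
        simp only [map_add, hP, hPQ0, zero_add]
      rw [← hPQ (β p), hβQ, ← h1, hPQ]
    refine ⟨p, ?_⟩
    have h1 : H p = Q z := by
      rw [(hHiff (Q z) p).mp (hα' ▸ hα p), hHid _ (hPQ0 z)]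
    have h2 : H' p = P z := by
      rw [(hHiff' (P z) p).mp (hβ' ▸ hβ p), hHid' _ (hQP0 z)]
    rw [h1, h2, hQP]
  have hbij : Function.Bijective fun x => H x + H' x := by
    refine ⟨fun x y hxy => ?_, hsurj⟩
    have h1 := congrArg Q hxy
    have h2 := congrArg P hxy
    simp only [hQS, hPS] at h1 h2
    exact hinj x y ((hHiff x y).mpr h1.symm) ((hHiff' x y).mpr h2.symm)
  have hc : Continuous fun x => H x + H' x := hHc.add hHc'
  let e : E ≃ E := Equiv.ofBijective _ hbij
  have he : ∀ x, e x = H x + H' x := fun x => rfl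
  -- Sliding moves `Q x` by at most `κ * ‖P x‖` and `P x` by at most `κ * ‖Q x‖`. The resulting
  -- linear bound keeps the inverse bounded on bounded sets, so its closed graph makes it
  -- continuous.
  have hbound : ∀ x, (1 - q) * ‖x‖ ≤ (‖P‖ + ‖Q‖) * ‖e x‖ := fun x => by
    have h1 := hR.norm_le x (H x) (hH x)
    have h2 := hR'.norm_le x (H' x) (hH' x)
    rw [map_sub P, hH0, zero_sub, norm_neg, map_sub, hQH, ← hQS, ← he, norm_sub_rev] at h1
    rw [map_sub Q, hH0', zero_sub, norm_neg, map_sub, hPH', ← hPS, ← he, norm_sub_rev] at h2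
    have h3 := norm_sub_norm_le (Q x) (Q (e x))
    have h4 := norm_sub_norm_le (P x) (P (e x))
    have h5 := P.le_opNorm (e x)
    have h6 := Q.le_opNorm (e x)
    have h7 := hsplit x
    have h8 := hcontr x
    linarith
  refine ⟨⟨e, hc, continuous_of_isClosed_graph_of_bounded ?_ fun C => ?_⟩, ?_, ?_, ?_, ?_, ?_, ?_,
    ?_⟩
  · have : {p : E × E | p.2 = e.symm p.1} = {p : E × E | e p.2 = p.1} := by
      ext p
      exact Equiv.eq_symm_apply e
    change IsClosed {p : E × E | p.2 = e.symm p.1}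
    rw [this]
    exact isClosed_eq (hc.comp continuous_snd) continuous_fst
  · refine ⟨(‖P‖ + ‖Q‖) * C / (1 - q), fun z hz => ?_⟩
    have h1 := hbound (e.symm z)
    rw [Equiv.apply_symm_apply] at h1
    rw [le_div_iff₀ (sub_pos.mpr hsmall), mul_comm]
    exact h1.trans (mul_le_mul_of_nonneg_left hz (by positivity))
  · change H 0 + H' 0 = 0
    rw [hHid 0 (map_zero _), hHid' 0 (map_zero _), add_zero]
  · intro x y
    change _ ↔ Q (H y + H' y) = Q (H x + H' x)
    rw [hQS, hQS, hHiff]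
  · intro x y
    change _ ↔ P (H y + H' y) = P (H x + H' x)
    rw [hPS, hPS, hHiff']
  · intro x
    change R x (Q (H x + H' x))
    rw [hQS]
    exact hH x
  · intro x
    change R' x (P (H x + H' x))
    rw [hPS]
    exact hH' x
  · intro x hx
    change Q (H x + H' x) = x
    rw [hQS, hHid x hx]
  · intro x hx
    change P (H x + H' x) = x
    rw [hPS, hHid' x hx]

end IsLipschitzFoliation

end Foliations

/-! ### Leaves under time reversal and under the flow -/

section Leaves

variable {n : ℕ} {F : ℝ → Phase n → Phase n}

theorem unstableLeaf_eq_stableLeaf_reverseField (F : ℝ → Phase n → Phase n) (τ : ℝ)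
    (x : Phase n) : unstableLeaf F τ x = stableLeaf (reverseField F) (-τ) x := by
  ext y
  constructor
  · rintro ⟨u, v, hu, hv, hux, hvy, M, hM⟩
    exact ⟨_, _, hu.reverse, hv.reverse, by simpa using hux, by simpa using hvy, M,
      fun t ht => hM (-t) (by linarith)⟩
  · rintro ⟨u, v, hu, hv, hux, hvy, M, hM⟩
    have hu' := hu.reverse
    have hv' := hv.reverse
    rw [reverseField_reverseField] at hu' hv'
    exact ⟨_, _, hu', hv', hux, hvy, M, fun t ht => hM (-t) (neg_le_neg ht)⟩

theorem exists_bound_Ici_of_continuous {g : ℝ → ℝ} (hg : Continuous g) {a : ℝ} (b : ℝ)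
    (h : ∃ M, ∀ t, a ≤ t → g t ≤ M) : ∃ M, ∀ t, b ≤ t → g t ≤ M := by
  obtain ⟨M, hM⟩ := h
  obtain ⟨C, hC⟩ := (isCompact_Icc (a := b) (b := a)).exists_bound_of_continuousOn hg.continuousOn
  refine ⟨max M C, fun t ht => ?_⟩
  rcases le_total a t with hat | hta
  · exact (hM t hat).trans (le_max_left _ _)
  · exact ((le_abs_self _).trans (hC t ⟨ht, hta⟩)).trans (le_max_right _ _)

variable {Φ : ℝ → Phase n ≃ₜ Phase n}

/-- The flow carries leaves to leaves: continuity on the compact interval between `0` and `t` makes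
boundedness on a forward half-line independent of its starting point. -/
theorem mem_stableLeaf_iff_symm (hΦ0 : ∀ x, Φ 0 x = x)
    (hΦ : ∀ u : ℝ → Phase n, IsSolution F u ↔ ∀ t, u t = Φ t (u 0)) (t : ℝ) (x y : Phase n) :
    y ∈ stableLeaf F t x ↔ (Φ t).symm y ∈ stableLeaf F 0 ((Φ t).symm x) := by
  have hsol : ∀ z, IsSolution F fun r => Φ r ((Φ t).symm z) := fun z =>
    (hΦ _).mpr fun r => by rw [hΦ0]
  constructor
  · rintro ⟨u, v, hu, hv, rfl, rfl, hM⟩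
    refine ⟨u, v, hu, hv, ?_, ?_,
      exists_bound_Ici_of_continuous (hu.continuous.sub hv.continuous).norm 0 hM⟩
    · rw [(hΦ u).mp hu t, Homeomorph.symm_apply_apply]
    · rw [(hΦ v).mp hv t, Homeomorph.symm_apply_apply]
  · rintro ⟨u, v, hu, hv, hu0, hv0, hM⟩
    refine ⟨u, v, hu, hv, ?_, ?_,
      exists_bound_Ici_of_continuous (hu.continuous.sub hv.continuous).norm t hM⟩
    · rw [(hΦ u).mp hu t, hu0, Homeomorph.apply_symm_apply]
    · rw [(hΦ v).mp hv t, hv0, Homeomorph.apply_symm_apply]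

theorem mem_unstableLeaf_iff_symm (hΦ0 : ∀ x, Φ 0 x = x)
    (hΦ : ∀ u : ℝ → Phase n, IsSolution F u ↔ ∀ t, u t = Φ t (u 0)) (t : ℝ) (x y : Phase n) :
    y ∈ unstableLeaf F t x ↔ (Φ t).symm y ∈ unstableLeaf F 0 ((Φ t).symm x) := by
  rw [unstableLeaf_eq_stableLeaf_reverseField, unstableLeaf_eq_stableLeaf_reverseField, neg_zero,
    mem_stableLeaf_iff_symm (Φ := fun r => Φ (-r)) (by simpa using hΦ0), neg_neg]
  intro u
  constructor
  · intro hu r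
    have hu' := hu.reverse
    rw [reverseField_reverseField] at hu'
    simpa using (hΦ _).mp hu' (-r)
  · intro hu
    have : IsSolution F fun r => u (-r) := (hΦ _).mpr fun r => by
      simpa using hu (-r)
    simpa using this.reverse

end Leaves

/-! ### The two foliations at time `0` -/

namespace PerturbedDichotomy

variable {n : ℕ} {μ : ℝ → ℝ} {A : ℝ → Phase n →L[ℝ] Phase n}
  {Ψ : ℝ → ℝ → Phase n →L[ℝ] Phase n} {π : ℝ → Phase n →L[ℝ] Phase n}
  {f : ℝ → Phase n → Phase n} {D lamS lamU ν ω θ δ : ℝ}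

theorem isLipschitzFoliation_stable (h : PerturbedDichotomy μ A Ψ π f D lamS lamU ν ω θ δ) :
    IsLipschitzFoliation (fun x y => y ∈ stableLeaf (fullField A f) 0 x) (π 0) (coProj π 0)
      (1 / (4 * D)) := by
  obtain ⟨k, hk⟩ := h.exists_caratheodoryLipschitz_full
  obtain ⟨Φ, hΦ0, -, hΦ⟩ := hk.exists_flow
  have hsol : ∀ z, IsSolution (fullField A f) fun r => Φ r z := fun z =>
    (hΦ _).mpr fun r => by rw [hΦ0]
  refine ⟨⟨fun x => ?_, ?_, ?_⟩, ?_, h.exists_mem_stableLeaf, ?_⟩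
  · exact ⟨_, _, hsol x, hsol x, hΦ0 x, hΦ0 x, 0, by simp⟩
  · rintro x y ⟨u, v, hu, hv, hux, hvy, M, hM⟩
    exact ⟨v, u, hv, hu, hvy, hux, M, fun t ht => norm_sub_rev (u t) (v t) ▸ hM t ht⟩
  · rintro x y z ⟨u, v, hu, hv, hux, hvy, M, hM⟩ ⟨v', w, hv', hw, hvy', hwz, M', hM'⟩
    refine ⟨u, w, hu, hw, hux, hwz, M + M', fun t ht => ?_⟩
    have hvv := hk.eq_of_eq hv hv' (hvy.trans hvy'.symm) t
    have := norm_add_le_of_le (hM t ht) (hM' t ht)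
    rwa [hvv, sub_add_sub_cancel] at this
  -- The a priori estimate replaces the unspecified bound by an explicit one, so the relation is an
  -- intersection of closed conditions.
  · have : {p : Phase n × Phase n | p.2 ∈ stableLeaf (fullField A f) 0 p.1}
        = {p | ∀ t, 0 ≤ t → ‖Φ t p.1 - Φ t p.2‖ ≤ 2 * D * ‖π 0 (p.1 - p.2)‖} := by
      ext ⟨x, y⟩
      constructor
      · rintro ⟨u, v, hu, hv, rfl, rfl, hM⟩ t ht
        have := h.norm_sub_le_of_bounded hu hv hM ht
        rwa [(hΦ u).mp hu t, (hΦ v).mp hv t] at this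
      · intro hxy
        exact ⟨_, _, hsol x, hsol y, hΦ0 x, hΦ0 y, _, hxy⟩
    rw [this]
    simp only [Set.ofPred_forall]
    refine isClosed_iInter fun t => isClosed_iInter fun _ => isClosed_le ?_ ?_
    · exact (((Φ t).continuous.comp continuous_fst).sub
        ((Φ t).continuous.comp continuous_snd)).norm
    · exact continuous_const.mul
        ((π 0).continuous.comp (continuous_fst.sub continuous_snd)).norm
  · rintro _ _ ⟨u, v, hu, hv, rfl, rfl, M, hM⟩
    exact h.norm_coProj_zero_sub_le hv hu ⟨M, fun t ht => norm_sub_rev (u t) (v t) ▸ hM t ht⟩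

theorem isLipschitzFoliation_unstable (h : PerturbedDichotomy μ A Ψ π f D lamS lamU ν ω θ δ) :
    IsLipschitzFoliation (fun x y => y ∈ unstableLeaf (fullField A f) 0 x) (coProj π 0) (π 0)
      (1 / (4 * D)) := by
  have := h.reverse.isLipschitzFoliation_stable
  rw [fullField_reverse] at this
  simpa [unstableLeaf_eq_stableLeaf_reverseField, coProj] using this

end PerturbedDichotomy

/-- Right-hand side of the decoupled system, written as a single equation on `ℝⁿ`. -/
noncomputable def decoupledField {n : ℕ} (A π : ℝ → Phase n →L[ℝ] Phase n)
    (f : ℝ → Phase n → Phase n) (t : ℝ) (z : Phase n) : Phase n :=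
  A t z + (π t (f t (π t z)) + coProj π t (f t (coProj π t z)))

/-! ### The decoupled flow and the conjugacy -/

namespace PerturbedDichotomy

variable {n : ℕ} {μ : ℝ → ℝ} {A : ℝ → Phase n →L[ℝ] Phase n}
  {Ψ : ℝ → ℝ → Phase n →L[ℝ] Phase n} {π : ℝ → Phase n →L[ℝ] Phase n}
  {f : ℝ → Phase n → Phase n} {D lamS lamU ν ω θ δ : ℝ}

theorem exists_caratheodoryLipschitz_decoupled
    (h : PerturbedDichotomy μ A Ψ π f D lamS lamU ν ω θ δ) :
    ∃ k, IsCaratheodoryLipschitz (decoupledField A π f) k :=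
  ⟨_, (isCaratheodoryLipschitz_linear h.locallyIntegrable).add
    ((h.caratheodoryLipschitz_perturbation.comp_clm h.continuous_proj h.continuous_proj).add
      (h.caratheodoryLipschitz_perturbation.comp_clm h.continuous_coProj h.continuous_coProj))⟩

/-- The projections depend on time and are known to intertwine `Ψ`, not `A`. Projecting a solution
is therefore done in the variation of constants formula; the converse is plain addition. -/
theorem isSolution_decoupledField_iff (h : PerturbedDichotomy μ A Ψ π f D lamS lamU ν ω θ δ)
    {z : ℝ → Phase n} :
    IsSolution (decoupledField A π f) z ↔
      IsSolution (stableField A π f) (fun t => π t (z t)) ∧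
        IsSolution (unstableField A π f) (fun t => coProj π t (z t)) := by
  constructor
  · intro hz
    have hp := (h.evolution.isSolution_add_iff h.locallyIntegrable).mp hz
    refine ⟨(h.evolution.isSolution_add_iff h.locallyIntegrable).mpr ?_,
      (h.evolution.isSolution_add_iff h.locallyIntegrable).mpr ?_⟩
    · simpa only [map_add, h.proj_apply_self, h.proj_coProj, map_zero, add_zero] using
        h.isPrimitive_evolution_proj hp 0
    · simpa only [map_add, h.coProj_apply_self, h.coProj_proj, map_zero, zero_add] using
        h.isPrimitive_evolution_coProj hp 0
  · rintro ⟨hs, hu⟩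
    have hadd := hs.isPrimitive.add hu.isPrimitive
    refine IsPrimitive.isSolution ?_
    have e : ∀ t, decoupledField A π f t (z t)
        = stableField A π f t (π t (z t)) + unstableField A π f t (coProj π t (z t)) := fun t => by
      have hA : A t (z t) = A t (π t (z t)) + A t (coProj π t (z t)) := by
        rw [← map_add, proj_add_coProj]
      simp only [decoupledField, stableField, unstableField, hA]
      abel
    simpa only [e, proj_add_coProj] using hadd

/-- The conjugacy between the full and the decoupled equation. -/
theorem exists_conjugacy (h : PerturbedDichotomy μ A Ψ π f D lamS lamU ν ω θ δ) :
    ∃ S : ℝ → Phase n ≃ₜ Phase n,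
      (∀ t, S t 0 = 0) ∧
      (∀ x : ℝ → Phase n, IsSolution (fullField A f) x ↔
        IsSolution (stableField A π f) (fun t => π t (S t (x t))) ∧
        IsSolution (unstableField A π f) (fun t => coProj π t (S t (x t)))) ∧
      (∀ t x y, y ∈ stableLeaf (fullField A f) t x ↔
        coProj π t (S t y) = coProj π t (S t x)) ∧
      (∀ t x y, y ∈ unstableLeaf (fullField A f) t x ↔
        π t (S t y) = π t (S t x)) ∧
      ((∀ t x, π t (f t (coProj π t x)) = 0 ∧ coProj π t (f t (π t x)) = 0) →
        ∀ t x,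
          stableLeaf (fullField A f) t x ∩ unstableSubspace π t = {coProj π t (S t x)} ∧
          unstableLeaf (fullField A f) t x ∩ stableSubspace π t = {π t (S t x)}) := by
  have hD := h.D_pos
  obtain ⟨k, hk⟩ := h.exists_caratheodoryLipschitz_full
  obtain ⟨l, hl⟩ := h.exists_caratheodoryLipschitz_decoupled
  obtain ⟨ks, hks⟩ := h.exists_caratheodoryLipschitz_stable
  obtain ⟨ku, hku⟩ := h.exists_caratheodoryLipschitz_unstable
  obtain ⟨Φ, hΦ0, hΦz, hΦ⟩ := hk.exists_flow
  obtain ⟨Θ, hΘ0, hΘz, hΘ⟩ := hl.exists_flow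
  have hΘsol : ∀ z, IsSolution (decoupledField A π f) fun r => Θ r z := fun z =>
    (hΘ _).mpr fun r => by rw [hΘ0]
  -- Both projections have norm at most `D` at time `0`, so the left side is at most `1 / 2`.
  have hsmall : 1 / (4 * D) * (‖π 0‖ + ‖coProj π 0‖) < 1 := by
    rw [one_div_mul_eq_div, div_lt_one (by positivity)]
    linarith [h.norm_proj_zero_le, h.norm_coProj_zero_le]
  obtain ⟨S₀, hS0, hSs, hSu, hSsm, hSum, hSsid, hSuid⟩ :=
    h.isLipschitzFoliation_stable.exists_homeomorph h.isLipschitzFoliation_unstable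
      (proj_add_coProj π 0) (h.proj_apply_self 0) (by positivity) hsmall
  -- Each component of `Θ` solves its own equation, so uniqueness makes equality of one component at
  -- time `t` equivalent to equality at time `0`.
  have hΘs : ∀ t z z', π t (Θ t z) = π t (Θ t z') ↔ π 0 z = π 0 z' := fun t z z' => by
    have h1 := (h.isSolution_decoupledField_iff.mp (hΘsol z)).1
    have h2 := (h.isSolution_decoupledField_iff.mp (hΘsol z')).1
    refine ⟨fun e => ?_, fun e => hks.eq_of_eq h1 h2 (s := 0) (by simpa only [hΘ0] using e) t⟩
    simpa only [hΘ0] using hks.eq_of_eq h1 h2 e 0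
  have hΘu : ∀ t z z', coProj π t (Θ t z) = coProj π t (Θ t z') ↔ coProj π 0 z = coProj π 0 z' :=
    fun t z z' => by
    have h1 := (h.isSolution_decoupledField_iff.mp (hΘsol z)).2
    have h2 := (h.isSolution_decoupledField_iff.mp (hΘsol z')).2
    refine ⟨fun e => ?_, fun e => hku.eq_of_eq h1 h2 (s := 0) (by simpa only [hΘ0] using e) t⟩
    simpa only [hΘ0] using hku.eq_of_eq h1 h2 e 0
  have hΦ0s : ∀ x, (Φ 0).symm x = x := fun x => by
    rw [Homeomorph.symm_apply_eq, hΦ0]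
  refine ⟨fun t => (Φ t).symm.trans (S₀.trans (Θ t)), fun t => ?_, fun x => ?_, fun t x y => ?_,
    fun t x y => ?_, fun hinv t x => ⟨?_, ?_⟩⟩
  · have : (Φ t).symm 0 = 0 := by rw [Homeomorph.symm_apply_eq, hΦz]
    simp [this, hS0, hΘz]
  · rw [← h.isSolution_decoupledField_iff, hΦ, hΘ]
    refine forall_congr' fun t => ?_
    simp only [Homeomorph.trans_apply, hΦ0s, hΘ0, (Θ t).injective.eq_iff, S₀.injective.eq_iff]
    rw [Homeomorph.symm_apply_eq]
  · rw [mem_stableLeaf_iff_symm hΦ0 hΦ, hSs]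
    exact (hΘu t _ _).symm
  · rw [mem_unstableLeaf_iff_symm hΦ0 hΦ, hSu]
    exact (hΘs t _ _).symm
  -- On the unstable subspaces the stable component of `f` now vanishes, so the unstable equation
  -- coincides there with the full one and the two flows agree. Intersection points at time `t` are
  -- thereby pulled back to time `0`.
  · have hflow : ∀ t z, coProj π t (Θ t z) = Φ t (coProj π 0 z) := fun t z => by
      have hv := (h.isSolution_decoupledField_iff.mp (hΘsol z)).2.isPrimitive
      have e : ∀ r, unstableField A π f r (coProj π r (Θ r z))
          = fullField A f r (coProj π r (Θ r z)) := fun r => by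
        have := proj_add_coProj π r (f r (coProj π r (Θ r z)))
        rw [(hinv r _).1, zero_add] at this
        rw [unstableField, fullField, this]
      simp only [e] at hv
      simpa only [hΘ0] using (hΦ _).mp (IsPrimitive.isSolution hv) t
    ext y
    simp only [Homeomorph.trans_apply, Set.mem_inter_iff, Set.mem_singleton_iff]
    rw [mem_stableLeaf_iff_symm hΦ0 hΦ, hflow, ← Homeomorph.symm_apply_eq]
    constructor
    · rintro ⟨hy, y', rfl⟩
      have hy0 : (Φ t).symm (coProj π t y') = coProj π 0 ((Θ t).symm y') := by
        rw [Homeomorph.symm_apply_eq, ← hflow, Homeomorph.apply_symm_apply]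
      rw [← (hSs _ _).mp hy, hy0, hSsid _ (h.proj_coProj _ _)]
    · intro hy
      rw [hy]
      exact ⟨hSsm _, Θ t (S₀ ((Φ t).symm x)), by rw [hflow, ← hy, Homeomorph.apply_symm_apply]⟩
  · have hflow : ∀ t z, π t (Θ t z) = Φ t (π 0 z) := fun t z => by
      have hv := (h.isSolution_decoupledField_iff.mp (hΘsol z)).1.isPrimitive
      have e : ∀ r, stableField A π f r (π r (Θ r z))
          = fullField A f r (π r (Θ r z)) := fun r => by
        have := proj_add_coProj π r (f r (π r (Θ r z)))
        rw [(hinv r _).2, add_zero] at this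
        rw [stableField, fullField, this]
      simp only [e] at hv
      simpa only [hΘ0] using (hΦ _).mp (IsPrimitive.isSolution hv) t
    ext y
    simp only [Homeomorph.trans_apply, Set.mem_inter_iff, Set.mem_singleton_iff]
    rw [mem_unstableLeaf_iff_symm hΦ0 hΦ, hflow, ← Homeomorph.symm_apply_eq]
    constructor
    · rintro ⟨hy, y', rfl⟩
      have hy0 : (Φ t).symm (π t y') = π 0 ((Θ t).symm y') := by
        rw [Homeomorph.symm_apply_eq, ← hflow, Homeomorph.apply_symm_apply]
      rw [← (hSu _ _).mp hy, hy0, hSuid _ (h.coProj_proj _ _)]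
    · intro hy
      rw [hy]
      exact ⟨hSum _, Θ t (S₀ ((Φ t).symm x)), by rw [hflow, ← hy, Homeomorph.apply_symm_apply]⟩

end PerturbedDichotomy

/-! ### Choice of the smallness constant and conclusion -/

theorem lemma4p1 (D lamS lamU ν ω θ : ℝ)
    (hθ : max ν ω ≤ θ) (hs : lamS < ν - θ) (hu : θ - ω < lamU) :
    ∃ δ₀ : ℝ, 0 < δ₀ ∧
      ∀ (n : ℕ) (μ : ℝ → ℝ) (A : ℝ → Phase n →L[ℝ] Phase n)
        (Ψ : ℝ → ℝ → Phase n →L[ℝ] Phase n) (π : ℝ → Phase n →L[ℝ] Phase n)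
        (f : ℝ → Phase n → Phase n) (δ : ℝ),
        IsDifferentiableGrowthRate μ →
        LocallyIntegrable A volume →
        IsEvolutionOperator A Ψ →
        HasNonuniformDichotomy μ Ψ π D lamS lamU ν ω →
        0 < δ → δ < δ₀ →
        IsAdmissiblePerturbation (lipWeight μ θ δ) f →
        -- the decoupled equations are contractive and expansive, respectively
        (lamS + D * δ < 0 ∧
          ContractsAtRate μ (stableField A π f) (stableSubspace π) D (lamS + D * δ) ν) ∧
        (0 < lamU - D * δ ∧
          ExpandsAtRate μ (unstableField A π f) (unstableSubspace π) D (lamU - D * δ) ω) ∧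
        ∃ S : ℝ → Phase n ≃ₜ Phase n,
          (∀ t, S t 0 = 0) ∧
          -- conjugacy: solutions correspond to pairs of solutions of the decoupled equations
          (∀ x : ℝ → Phase n, IsSolution (fullField A f) x ↔
            IsSolution (stableField A π f) (fun t => π t (S t (x t))) ∧
            IsSolution (unstableField A π f) (fun t => coProj π t (S t (x t)))) ∧
          -- `S t` straightens the stable and unstable foliations
          (∀ t x y, y ∈ stableLeaf (fullField A f) t x ↔
            coProj π t (S t y) = coProj π t (S t x)) ∧
          (∀ t x y, y ∈ unstableLeaf (fullField A f) t x ↔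
            π t (S t y) = π t (S t x)) ∧
          -- once the invariant manifolds are the linear subspaces themselves, the components of
          -- `S t x` are the points where the leaves through `x` meet these subspaces
          ((∀ t x, π t (f t (coProj π t x)) = 0 ∧ coProj π t (f t (π t x)) = 0) →
            ∀ t x,
              stableLeaf (fullField A f) t x ∩ unstableSubspace π t = {coProj π t (S t x)} ∧
              unstableLeaf (fullField A f) t x ∩ stableSubspace π t = {π t (S t x)}) := by
  obtain ⟨δ₀, hδ₀, hsmall⟩ : ∃ δ₀ : ℝ, 0 < δ₀ ∧ (1 ≤ D → lamS < 0 → 0 < lamU →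
      ∀ δ, δ < δ₀ → 8 * D ^ 3 * δ < -lamS ∧ 8 * D ^ 3 * δ < lamU) := by
    -- The constant `δ₀` must be chosen before the dichotomy supplies these signs. When they hold it
    -- is `min (-lamS) lamU / (8 * D ^ 3)`; otherwise no dichotomy exists and the value `1` is
    -- arbitrary.
    by_cases hp : 1 ≤ D ∧ lamS < 0 ∧ 0 < lamU
    · obtain ⟨hD, hls, hlu⟩ := hp
      have hD3 : 0 < 8 * D ^ 3 := by positivity
      refine ⟨min (-lamS) lamU / (8 * D ^ 3), div_pos (lt_min (neg_pos.mpr hls) hlu) hD3,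
        fun _ _ _ δ hδ => ?_⟩
      rw [lt_div_iff₀ hD3, mul_comm] at hδ
      exact ⟨hδ.trans_le (min_le_left _ _), hδ.trans_le (min_le_right _ _)⟩
    · exact ⟨1, one_pos, fun h1 h2 h3 => absurd ⟨h1, h2, h3⟩ hp⟩
  refine ⟨δ₀, hδ₀, fun n μ A Ψ π f δ hμ hA hΨ hdich hδ hδlt hf => ?_⟩
  obtain ⟨h1, h2⟩ := hsmall hdich.one_le hdich.lamS_neg hdich.lamU_pos δ hδlt
  have h : PerturbedDichotomy μ A Ψ π f D lamS lamU ν ω θ δ :=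
    ⟨hμ, hA, hΨ, hdich, (le_max_left _ _).trans hθ, (le_max_right _ _).trans hθ, hδ, h1, h2, hf⟩
  exact ⟨⟨h.stable_rate_neg, h.contractsAtRate⟩, ⟨h.unstable_rate_pos, h.expandsAtRate⟩,
    h.exists_conjugacy⟩
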